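/- Let $p>2$ be a prime and let $k$ be a perfect field of characteristic $p$. Let $\mathfrak g$ be a one-dimensional restricted Lie algebra over $k$ with a nonzero element $z$, and let $\lambda\in k$ be the scalar with $z^{p}+\lambda z=0$, where $(\ )^p$ denotes the restricted $p$-map. Let $\mathfrak h$ be a finite-dimensional abelian restricted Lie algebra over $k$ with basis $x_1,\dots,x_d$. Let $\rho$ be an algebraic representation of $\mathfrak g$ on $\mathfrak h$, that is, a linear map $\rho:\mathfrak g\to\operatorname{End}_k(\mathfrak h)$, $u\mapsto\rho_u$, with $$\rho_{[u,v]}=\rho_u\rho_v-\rho_v\rho_u,\quad \rho_{u^p}=(\rho_u)^p,\quad \rho_u([a,b])=[\rho_u(a),b]+[a,\rho_u(b)],\quad \rho_u(a^p)=(\operatorname{ad}a)^{p-1}(\rho_u(a))$$ for all $u,v\in\mathfrak g$ and $a,b\in\mathfrak h$. Let $A=u(\mathfrak h)$ be the restricted universal enveloping algebra, a commutative Hopf algebra in which the elements of $\mathfrak h$ are primitive, with augmentation ideal $A^+$, and extend $\rho_z$ to a derivation of $A$. Let $\mathrm H^2(\Omega A)$ be the second cohomology of the cobar complex $$A^+\xrightarrow{d^1}A^+\otimes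 A^+\xrightarrow{d^2}A^+\otimes A^+\otimes A^+,\qquad d^1=-\overline\Delta,\quad d^2(a\otimes b)=-\overline\Delta(a)\otimes b+a\otimes\overline\Delta(b),$$ where $\overline\Delta(a)=\Delta(a)-a\otimes1-1\otimes a$. The operator $$\Phi_z(\chi)=\chi^p+\lambda\chi+\rho_z^{p-1}(\chi)$$ on $A^+\otimes A^+$ (with $p$-th powers taken in $A\otimes A$, and $\rho_z$ acting as $\rho_z\otimes1+1\otimes\rho_z$) induces an additive operator $\Phi_z$ on $\mathrm H^2(\Omega A)$. A class $\xi\in\mathrm H^2(\Omega A)$ is called $z$-characteristic if $\Phi_z(\xi)=0$. For $a,b\in\mathfrak h$ write $a\wedge b=[a\otimes b]\in\mathrm H^2(\Omega A)$ and $\omega(a)=\Big[\sum_{i=1}^{p-1}\tfrac1p\tbinom pi\,a^i\otimes a^{p-i}\Big]\in\mathrm H^2(\Omega A)$. Let $\mu_{ij}$ $(1\le i<j\le d)$ and $\mu_i$ $(1\le i\le d)$ be elements of $k$, put $x=\sum_{i}\mu_ix_i\in\mathfrak h$ and $$\xi=\sum_{1\le i<j\le d}\mu_{ij}\,x_i\wedge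 x_j+\omega(x)\in\mathrm H^2(\Omega A).$$ Then $\xi$ is $z$-characteristic if and only if $x^p+\lambda^{1/p}x=0$ and the following equality holds in the exterior square $\Lambda^2(\mathfrak h)$: $$\sum_{1\le i<j\le d}\mu_{ij}^p\,x_i^p\wedge x_j^p+\sum_{1\le i<j\le d}\lambda\mu_{ij}\,x_i\wedge x_j+\sum_{\substack{k+l=p-1\\1\le i<j\le d}}\binom{p-1}{k}\mu_{ij}\,\rho_z^k(x_i)\wedge\rho_z^l(x_j)=0 .$$ (In the last sum $k,l\ge0$ are integers.) -/

import Mathlib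

open scoped TensorProduct Polynomial

set_option linter.unusedSectionVars false

noncomputable section

/-- Jacobson's polynomials: `i • sᵢ(a, b)` is the coefficient of `t ^ (i - 1)` in
`(ad (t • a + b)) ^ (p - 1) (a)`. -/
def jacobsonS (p : ℕ) (k : Type*) {L : Type*} [Field k] [LieRing L] [LieAlgebra k L]
    (i : ℕ) (a b : L) : L :=
  (i : k)⁻¹ • (((Polynomial.X * Polynomial.C (LieAlgebra.ad k L a) +
    Polynomial.C (LieAlgebra.ad k L b) : (Module.End k L)[X]) ^ (p - 1)).coeff (i - 1)) a

/-- Restricted Lie algebras over a field of characteristic `p`. -/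
class RestrictedLieAlgebra (p : ℕ) (k : Type*) (L : Type*) [Field k] [LieRing L]
    [LieAlgebra k L] where
  /-- The `p`-map `x ↦ x^[p]`. -/
  pMap : L → L
  ad_pMap : ∀ x : L, LieAlgebra.ad k L (pMap x) = LieAlgebra.ad k L x ^ p
  pMap_smul : ∀ (c : k) (x : L), pMap (c • x) = c ^ p • pMap x
  pMap_add : ∀ x y : L, pMap (x + y) =
    pMap x + pMap y + ∑ i ∈ Finset.Ico 1 p, jacobsonS p k i x y

/-- An algebraic representation of `𝔤` on `𝔥`. -/
structure AlgebraicRepresentation (p : ℕ) (k 𝔤 𝔥 : Type*) [Field k] [LieRing 𝔤] [LieAlgebra k 𝔤]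
    [RestrictedLieAlgebra p k 𝔤] [LieRing 𝔥] [LieAlgebra k 𝔥] [RestrictedLieAlgebra p k 𝔥] where
  toLin : 𝔤 →ₗ[k] Module.End k 𝔥
  map_lie : ∀ x y : 𝔤, toLin ⁅x, y⁆ = toLin x * toLin y - toLin y * toLin x
  map_pMap : ∀ x : 𝔤, toLin (RestrictedLieAlgebra.pMap p k x) = toLin x ^ p
  apply_lie : ∀ (x : 𝔤) (a b : 𝔥), toLin x ⁅a, b⁆ = ⁅toLin x a, b⁆ + ⁅a, toLin x b⁆
  apply_pMap : ∀ (x : 𝔤) (a : 𝔥), toLin x (RestrictedLieAlgebra.pMap p k a) =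
    (LieAlgebra.ad k 𝔥 a ^ (p - 1)) (toLin x a)

/-- The relations `x ^ p = x^[p]`, `x ∈ L`, in the universal enveloping algebra of `L`. -/
inductive RestrictedEnveloping.Rel (p : ℕ) (k L : Type*) [Field k] [LieRing L] [LieAlgebra k L]
    [RestrictedLieAlgebra p k L] :
    UniversalEnvelopingAlgebra k L → UniversalEnvelopingAlgebra k L → Prop
  | pow (x : L) : Rel p k L (UniversalEnvelopingAlgebra.ι k x ^ p)
      (UniversalEnvelopingAlgebra.ι k (RestrictedLieAlgebra.pMap p k x))

/-- The restricted universal enveloping algebra `u(L)`. -/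
def RestrictedEnveloping (p : ℕ) (k L : Type*) [Field k] [LieRing L] [LieAlgebra k L]
    [RestrictedLieAlgebra p k L] : Type _ :=
  RingQuot (RestrictedEnveloping.Rel p k L)

namespace RestrictedEnveloping

section Basic

variable (p : ℕ) (k L : Type*) [Field k] [LieRing L] [LieAlgebra k L]
    [RestrictedLieAlgebra p k L]

instance instRing : Ring (RestrictedEnveloping p k L) :=
  inferInstanceAs (Ring (RingQuot (RestrictedEnveloping.Rel p k L)))

instance instAlgebra : Algebra k (RestrictedEnveloping p k L) :=
  inferInstanceAs (Algebra k (RingQuot (RestrictedEnveloping.Rel p k L)))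

attribute [local instance 100] LieRing.ofAssociativeRing

/-- The quotient map `U(L) → u(L)`. -/
def mk : UniversalEnvelopingAlgebra k L →ₐ[k] RestrictedEnveloping p k L :=
  RingQuot.mkAlgHom k (Rel p k L)

/-- The canonical map `L → u(L)`. -/
def ι : L →ₗ[k] RestrictedEnveloping p k L :=
  (mk p k L).toLinearMap ∘ₗ (UniversalEnvelopingAlgebra.ι k : L →ₗ⁅k⁆ _).toLinearMap

variable {L}

theorem ι_pMap (x : L) : ι p k L (RestrictedLieAlgebra.pMap p k x) = ι p k L x ^ p := by
  have := RingQuot.mkAlgHom_rel k (Rel.pow (p := p) (k := k) x)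
  rw [map_pow] at this
  exact this.symm

theorem ι_lie (x y : L) : ι p k L ⁅x, y⁆ =
    ι p k L x * ι p k L y - ι p k L y * ι p k L x := by
  change mk p k L (UniversalEnvelopingAlgebra.ι k ⁅x, y⁆) = _
  rw [LieHom.map_lie, LieRing.of_associative_ring_bracket, map_sub, map_mul, map_mul]
  rfl

variable {p k}

/-- The universal property of `u(L)`. -/
def lift {A : Type*} [Ring A] [Algebra k A] (f : L →ₗ[k] A)
    (hl : ∀ x y, f ⁅x, y⁆ = f x * f y - f y * f x)
    (hp : ∀ x, f (RestrictedLieAlgebra.pMap p k x) = f x ^ p) :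
    RestrictedEnveloping p k L →ₐ[k] A :=
  RingQuot.liftAlgHom k
    ⟨UniversalEnvelopingAlgebra.lift k
      { f with map_lie' := fun {x y} => by
                simpa [LieRing.of_associative_ring_bracket] using hl x y }, by
      rintro _ _ ⟨x⟩
      rw [map_pow, UniversalEnvelopingAlgebra.lift_ι_apply, UniversalEnvelopingAlgebra.lift_ι_apply]
      exact (hp x).symm⟩

theorem lift_ι {A : Type*} [Ring A] [Algebra k A] (f : L →ₗ[k] A)
    (hl : ∀ x y, f ⁅x, y⁆ = f x * f y - f y * f x)
    (hp : ∀ x, f (RestrictedLieAlgebra.pMap p k x) = f x ^ p) (x : L) :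
    lift f hl hp (ι p k L x) = f x := by
  change RingQuot.liftAlgHom k _ (RingQuot.mkAlgHom k (Rel p k L) _) = _
  rw [RingQuot.liftAlgHom_mkAlgHom_apply]
  exact UniversalEnvelopingAlgebra.lift_ι_apply k _ x

theorem hom_ext {A : Type*} [Ring A] [Algebra k A] {f g : RestrictedEnveloping p k L →ₐ[k] A}
    (h : ∀ x, f (ι p k L x) = g (ι p k L x)) : f = g := by
  refine RingQuot.ringQuot_ext' k _ _ ?_
  apply UniversalEnvelopingAlgebra.hom_ext
  ext x
  exact h x

theorem mem_of_ι_mem (S : Subalgebra k (RestrictedEnveloping p k L)) (h : ∀ x, ι p k L x ∈ S)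
    (a : RestrictedEnveloping p k L) : a ∈ S := by
  let f : RestrictedEnveloping p k L →ₐ[k] S :=
    lift ((ι p k L).codRestrict S.toSubmodule h)
      (fun x y => Subtype.ext (ι_lie p k x y)) (fun x => Subtype.ext (ι_pMap p k x))
  have hf : S.val.comp f = AlgHom.id k _ := hom_ext fun x => by
    change S.val (lift _ _ _ _) = _
    rw [lift_ι]; rfl
  have := DFunLike.congr_fun hf a
  rw [← AlgHom.id_apply (R := k) a, ← this]
  exact (f a).2

end Basic

section Bialgebra

theorem add_pow_char_of_commute' {p : ℕ} (hp : p.Prime) (k : Type*) {A : Type*} [Field k] [CharP k p]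
    [Ring A] [Algebra k A] {x y : A} (h : Commute x y) : (x + y) ^ p = x ^ p + y ^ p := by
  have h0 : (p : A) = 0 := by
    rw [← map_natCast (algebraMap k A) p, CharP.cast_eq_zero, map_zero]
  rw [h.add_pow_prime_eq hp, h0]
  simp

variable (p : ℕ) (k L : Type*) [Fact p.Prime] [Field k] [CharP k p] [LieRing L] [LieAlgebra k L]
    [RestrictedLieAlgebra p k L]

/-- The linear map `x ↦ x ⊗ 1 + 1 ⊗ x` on `L`, with values in `u(L) ⊗ u(L)`. -/
def comulLin : L →ₗ[k] RestrictedEnveloping p k L ⊗[k] RestrictedEnveloping p k L :=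
  ((TensorProduct.mk k _ _).flip 1 + TensorProduct.mk k _ _ 1) ∘ₗ ι p k L

variable {L} in
theorem comulLin_apply (x : L) :
    comulLin p k L x = ι p k L x ⊗ₜ[k] 1 + 1 ⊗ₜ[k] ι p k L x := rfl

/-- The comultiplication: every `x ∈ L` is primitive. -/
def comulHom : RestrictedEnveloping p k L →ₐ[k]
    RestrictedEnveloping p k L ⊗[k] RestrictedEnveloping p k L :=
  lift (comulLin p k L)
    (fun x y => by
      simp only [comulLin_apply, ι_lie, TensorProduct.sub_tmul, TensorProduct.tmul_sub, mul_add,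
        add_mul, Algebra.TensorProduct.tmul_mul_tmul, one_mul, mul_one]
      abel)
    (fun x => by
      rw [comulLin_apply, comulLin_apply, add_pow_char_of_commute' Fact.out k
        (by simp [commute_iff_eq]), ι_pMap, Algebra.TensorProduct.tmul_pow,
        Algebra.TensorProduct.tmul_pow, one_pow])

/-- The counit: it kills `L`. -/
def counitHom : RestrictedEnveloping p k L →ₐ[k] k :=
  lift 0 (fun _ _ => by simp) (fun _ => by simp [(Fact.out : p.Prime).ne_zero])

variable {L}

theorem comulHom_ι (x : L) :
    comulHom p k L (ι p k L x) = ι p k L x ⊗ₜ[k] 1 + 1 ⊗ₜ[k] ι p k L x :=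
  lift_ι _ _ _ x

theorem counitHom_ι (x : L) : counitHom p k L (ι p k L x) = 0 :=
  lift_ι _ _ _ x

variable (L)

instance instBialgebra : Bialgebra k (RestrictedEnveloping p k L) :=
  Bialgebra.ofAlgHom (comulHom p k L) (counitHom p k L)
    (hom_ext fun x => by
      simp [comulHom_ι, TensorProduct.tmul_add, TensorProduct.add_tmul, add_assoc,
        Algebra.TensorProduct.one_def])
    (hom_ext fun x => by
      simp [comulHom_ι, counitHom_ι])
    (hom_ext fun x => by
      simp [comulHom_ι, counitHom_ι])

end Bialgebra

section Abelian

variable (p : ℕ) (k L : Type*) [Field k] [LieRing L] [LieAlgebra k L]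
    [RestrictedLieAlgebra p k L] [IsLieAbelian L]

theorem ι_mul_comm (x y : L) : ι p k L x * ι p k L y = ι p k L y * ι p k L x := by
  have := ι_lie p k x y
  rw [trivial_lie_zero, map_zero] at this
  exact (sub_eq_zero.mp this.symm)

theorem mul_comm_of_abelian (a b : RestrictedEnveloping p k L) : a * b = b * a := by
  have h1 : ∀ (x : L) (b : RestrictedEnveloping p k L), b * ι p k L x = ι p k L x * b := fun x b =>
    (Subalgebra.mem_centralizer_iff k).mp
      (mem_of_ι_mem (Subalgebra.centralizer k {ι p k L x}) (fun y => by
        rw [Subalgebra.mem_centralizer_iff]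
        rintro _ rfl
        exact ι_mul_comm p k L x y) b) _ rfl |>.symm
  exact (Subalgebra.mem_centralizer_iff k).mp
      (mem_of_ι_mem (Subalgebra.centralizer k {b}) (fun y => by
        rw [Subalgebra.mem_centralizer_iff]
        rintro _ rfl
        exact h1 y _) a) _ rfl |>.symm

/-- `u(L)` is commutative for abelian `L`. -/
instance instCommRing : CommRing (RestrictedEnveloping p k L) :=
  { instRing p k L with mul_comm := mul_comm_of_abelian p k L }

/-- The algebra map `u(L) → u(L)[ε]`, `x ↦ x + f(x) ε` for `x ∈ L`, where `L` is abelian and `f`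
kills all `p`-th powers. -/
def toDual [Fact p.Prime] [CharP k p] (f : L →ₗ[k] L)
    (hf : ∀ x, f (RestrictedLieAlgebra.pMap p k x) = 0) :
    RestrictedEnveloping p k L →ₐ[k] DualNumber (RestrictedEnveloping p k L) :=
  lift ((TrivSqZeroExt.inlAlgHom k (RestrictedEnveloping p k L)
      (RestrictedEnveloping p k L)).toLinearMap ∘ₗ ι p k L +
      (TrivSqZeroExt.inrHom (RestrictedEnveloping p k L)
        (RestrictedEnveloping p k L)).restrictScalars k ∘ₗ ι p k L ∘ₗ f)
    (fun x y => by rw [trivial_lie_zero, map_zero, mul_comm, sub_self])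
    (fun x => by
      have hp : p.Prime := Fact.out
      simp only [LinearMap.add_apply, LinearMap.comp_apply, hf, map_zero, add_zero, ι_pMap]
      rw [add_pow_char_of_commute' hp k (Commute.all _ _)]
      have h0 : ∀ m : RestrictedEnveloping p k L,
          (TrivSqZeroExt.inr m : DualNumber (RestrictedEnveloping p k L)) ^ p = 0 := fun m => by
        refine pow_eq_zero_of_le hp.two_le ?_
        rw [pow_two, TrivSqZeroExt.inr_mul_inr]
      change TrivSqZeroExt.inl _ = TrivSqZeroExt.inl _ ^ p + TrivSqZeroExt.inr _ ^ p
      rw [h0, add_zero, TrivSqZeroExt.inl_pow])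

theorem toDual_ι [Fact p.Prime] [CharP k p] (f : L →ₗ[k] L)
    (hf : ∀ x, f (RestrictedLieAlgebra.pMap p k x) = 0) (x : L) :
    toDual p k L f hf (ι p k L x) =
      TrivSqZeroExt.inl (ι p k L x) + TrivSqZeroExt.inr (ι p k L (f x)) :=
  lift_ι _ _ _ x

theorem fst_toDual [Fact p.Prime] [CharP k p] (f : L →ₗ[k] L)
    (hf : ∀ x, f (RestrictedLieAlgebra.pMap p k x) = 0) (a : RestrictedEnveloping p k L) :
    (toDual p k L f hf a).fst = a := by
  have : (TrivSqZeroExt.fstHom k (RestrictedEnveloping p k L) (RestrictedEnveloping p k L)).comp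
      (toDual p k L f hf) = AlgHom.id k _ := hom_ext fun x => by
    simp [toDual_ι]
  exact DFunLike.congr_fun this a

/-- The derivation of `u(L)`, `L` abelian, that extends a linear endomorphism `f` of `L` which kills
all `p`-th powers. -/
def derivation [Fact p.Prime] [CharP k p] (f : L →ₗ[k] L)
    (hf : ∀ x, f (RestrictedLieAlgebra.pMap p k x) = 0) :
    Derivation k (RestrictedEnveloping p k L) (RestrictedEnveloping p k L) :=
  Derivation.mk'
    ((TrivSqZeroExt.sndHom (RestrictedEnveloping p k L)
      (RestrictedEnveloping p k L)).restrictScalars k ∘ₗ (toDual p k L f hf).toLinearMap)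
    (fun a b => by
      change (toDual p k L f hf (a * b)).snd = a • (toDual p k L f hf b).snd +
        b • (toDual p k L f hf a).snd
      rw [map_mul, TrivSqZeroExt.snd_mul, fst_toDual, fst_toDual]
      simp [mul_comm])

theorem derivation_ι [Fact p.Prime] [CharP k p] (f : L →ₗ[k] L)
    (hf : ∀ x, f (RestrictedLieAlgebra.pMap p k x) = 0) (x : L) :
    derivation p k L f hf (ι p k L x) = ι p k L (f x) := by
  change (toDual p k L f hf (ι p k L x)).snd = _
  simp [toDual_ι]

end Abelian

end RestrictedEnveloping

namespace Cobar

section Complex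

variable (k A : Type*) [Field k] [CommRing A] [Bialgebra k A]

/-- The augmentation ideal `A⁺`. -/
def aug : Submodule k A := LinearMap.ker (Coalgebra.counit : A →ₗ[k] k)

/-- `A⁺ ⊗ A⁺`, as a subspace of `A ⊗ A` (`k` is a field). -/
def augSq : Submodule k (A ⊗[k] A) :=
  LinearMap.range (TensorProduct.map (aug k A).subtype (aug k A).subtype)

/-- `Δ̄(a) = Δ(a) - a ⊗ 1 - 1 ⊗ a`. -/
def redComul : A →ₗ[k] A ⊗[k] A :=
  Coalgebra.comul - (TensorProduct.mk k A A).flip 1 - TensorProduct.mk k A A 1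

/-- `d¹ = -Δ̄`; in the cobar complex it is restricted to `A⁺`. -/
def d1 : A →ₗ[k] A ⊗[k] A := -redComul k A

/-- `d²(a ⊗ b) = -Δ̄(a) ⊗ b + a ⊗ Δ̄(b)`; in the cobar complex it is restricted to `A⁺ ⊗ A⁺`. -/
def d2 : A ⊗[k] A →ₗ[k] A ⊗[k] (A ⊗[k] A) :=
  -((TensorProduct.assoc k A A A).toLinearMap ∘ₗ (redComul k A).rTensor A) +
    (redComul k A).lTensor A

/-- The 2-cocycles of the cobar complex. -/
def Z2 : Submodule k (A ⊗[k] A) := augSq k A ⊓ LinearMap.ker (d2 k A)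

/-- The 2-coboundaries of the cobar complex. -/
def B2 : Submodule k (A ⊗[k] A) := (aug k A).map (d1 k A)

variable {k A}

theorem mem_aug {a : A} : a ∈ aug k A ↔ Coalgebra.counit (R := k) a = 0 := LinearMap.mem_ker

theorem tmul_mem_augSq {a b : A} (ha : a ∈ aug k A) (hb : b ∈ aug k A) :
    a ⊗ₜ[k] b ∈ augSq k A := ⟨⟨a, ha⟩ ⊗ₜ ⟨b, hb⟩, rfl⟩

theorem augSq_induction {P : A ⊗[k] A → Prop} {c : A ⊗[k] A} (hc : c ∈ augSq k A)
    (h0 : P 0) (ht : ∀ a ∈ aug k A, ∀ b ∈ aug k A, P (a ⊗ₜ b))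
    (ha : ∀ x y, P x → P y → P (x + y)) : P c := by
  obtain ⟨t, rfl⟩ := hc
  induction t with
  | zero => simpa using h0
  | tmul a b => exact ht a a.2 b b.2
  | add x y hx hy => rw [map_add]; exact ha _ _ hx hy

theorem mul_mem_augSq {x y : A ⊗[k] A} (hx : x ∈ augSq k A) (hy : y ∈ augSq k A) :
    x * y ∈ augSq k A := by
  refine augSq_induction (P := fun x => x * y ∈ augSq k A) hx (by simp) (fun a ha b hb => ?_) (fun u v hu hv => ?_)
  · refine augSq_induction (P := fun y => a ⊗ₜ b * y ∈ augSq k A) hy (by simp) (fun a' _ b' _ => ?_) (fun u v hu hv => ?_)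
    · rw [Algebra.TensorProduct.tmul_mul_tmul]
      rw [mem_aug] at ha hb
      exact tmul_mem_augSq (by simp [mem_aug, ha]) (by simp [mem_aug, hb])
    · rw [mul_add]; exact add_mem hu hv
  · rw [add_mul]; exact add_mem hu hv

theorem pow_mem_augSq {x : A ⊗[k] A} (hx : x ∈ augSq k A) {n : ℕ} (hn : n ≠ 0) :
    x ^ n ∈ augSq k A := by
  obtain ⟨m, rfl⟩ := Nat.exists_eq_succ_of_ne_zero hn
  induction m with
  | zero => simpa using hx
  | succ m ih => rw [pow_succ]; exact mul_mem_augSq (ih (by simp)) hx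

variable (k A)

/-- `c ↦ 1 ⊗ c`. -/
def f0 : A ⊗[k] A →ₐ[k] A ⊗[k] (A ⊗[k] A) := Algebra.TensorProduct.includeRight

/-- `a ⊗ b ↦ Δ(a) ⊗ b`. -/
def f1 : A ⊗[k] A →ₐ[k] A ⊗[k] (A ⊗[k] A) :=
  (Algebra.TensorProduct.assoc k k k A A A).toAlgHom.comp
    (Algebra.TensorProduct.map (Bialgebra.comulAlgHom k A) (AlgHom.id k A))

/-- `a ⊗ b ↦ a ⊗ Δ(b)`. -/
def f2 : A ⊗[k] A →ₐ[k] A ⊗[k] (A ⊗[k] A) :=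
  Algebra.TensorProduct.map (AlgHom.id k A) (Bialgebra.comulAlgHom k A)

/-- `a ⊗ b ↦ a ⊗ b ⊗ 1`. -/
def f3 : A ⊗[k] A →ₐ[k] A ⊗[k] (A ⊗[k] A) :=
  Algebra.TensorProduct.map (AlgHom.id k A) Algebra.TensorProduct.includeLeft

variable {k A}

theorem d1_apply (a : A) : d1 k A a = a ⊗ₜ 1 + 1 ⊗ₜ a - Coalgebra.comul a := by
  simp only [d1, redComul, LinearMap.neg_apply, LinearMap.sub_apply, LinearMap.flip_apply,
    TensorProduct.mk_apply]
  abel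

theorem d2_apply (c : A ⊗[k] A) :
    d2 k A c = f0 k A c - f1 k A c + f2 k A c - f3 k A c := by
  induction c with
  | zero => simp
  | tmul a b =>
    have h : f1 k A (a ⊗ₜ b) = TensorProduct.assoc k A A A (Coalgebra.comul a ⊗ₜ b) := rfl
    rw [h]
    simp only [d2, f0, f2, f3, redComul, LinearMap.add_apply, LinearMap.neg_apply,
      LinearMap.comp_apply, LinearMap.rTensor_tmul, LinearMap.lTensor_tmul, LinearMap.sub_apply,
      LinearMap.flip_apply, TensorProduct.mk_apply, TensorProduct.sub_tmul, TensorProduct.tmul_sub,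
      map_sub, LinearEquiv.coe_coe, TensorProduct.assoc_tmul,
      Algebra.TensorProduct.includeRight_apply, Algebra.TensorProduct.map_tmul, AlgHom.id_apply,
      Algebra.TensorProduct.includeLeft_apply, Bialgebra.comulAlgHom_apply]
    abel
  | add x y hx hy => simp only [map_add, hx, hy]; abel

/-- Coboundaries are cocycles. -/
theorem B2_le_Z2 : B2 k A ≤ Z2 k A := by
  rintro _ ⟨a, ha, rfl⟩
  have ha' : Coalgebra.counit (R := k) a = 0 := ha
  refine ⟨?_, ?_⟩
  · let π : A →ₗ[k] aug k A := (LinearMap.id - Algebra.linearMap k A ∘ₗ Coalgebra.counit).codRestrict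
      _ (fun x => by simp [mem_aug])
    have hπ : (aug k A).subtype ∘ₗ π = LinearMap.id - Algebra.linearMap k A ∘ₗ Coalgebra.counit :=
      LinearMap.subtype_comp_codRestrict _ _ _
    refine ⟨TensorProduct.map π π (-Coalgebra.comul a), ?_⟩
    have e1 := Coalgebra.rTensor_counit_comul (R := k) a
    have e2 := Coalgebra.lTensor_counit_comul (R := k) a
    have h1 : ∀ c : A ⊗[k] A, TensorProduct.map (aug k A).subtype (aug k A).subtype
        (TensorProduct.map π π c) = c -
          TensorProduct.map (Algebra.linearMap k A) LinearMap.id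
            ((Coalgebra.counit : A →ₗ[k] k).rTensor A c) -
          TensorProduct.map LinearMap.id (Algebra.linearMap k A)
            ((Coalgebra.counit : A →ₗ[k] k).lTensor A c) +
          TensorProduct.map (Algebra.linearMap k A)
            (Algebra.linearMap k A ∘ₗ Coalgebra.counit)
            ((Coalgebra.counit : A →ₗ[k] k).rTensor A c) := fun c => by
      rw [← LinearMap.comp_apply, ← TensorProduct.map_comp, hπ]
      induction c with
      | zero => simp
      | tmul a b =>
        simp only [TensorProduct.map_tmul, LinearMap.sub_apply, LinearMap.id_apply,
          LinearMap.comp_apply, LinearMap.rTensor_tmul, LinearMap.lTensor_tmul,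
          TensorProduct.sub_tmul, TensorProduct.tmul_sub]
        abel
      | add x y hx hy => simp only [map_add, hx, hy]; abel
    rw [map_neg, map_neg, h1, e1, e2, d1_apply]
    simp only [TensorProduct.map_tmul, LinearMap.id_apply, LinearMap.comp_apply, ha',
      Algebra.linearMap_apply, map_one, map_zero, TensorProduct.tmul_zero]
    abel
  · have h3 : ∀ c : A ⊗[k] A, f3 k A c = TensorProduct.assoc k A A A (c ⊗ₜ 1) := fun c => by
      induction c with
      | zero => simp
      | tmul a b => rfl
      | add x y hx hy => rw [map_add, hx, hy, TensorProduct.add_tmul, map_add]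
    have h12 : f1 k A (Coalgebra.comul a) = f2 k A (Coalgebra.comul a) :=
      Coalgebra.coassoc_apply (R := k) a
    have ha1 : f1 k A (a ⊗ₜ 1) = TensorProduct.assoc k A A A (Coalgebra.comul a ⊗ₜ 1) := rfl
    have ha2 : f2 k A (1 ⊗ₜ a) = 1 ⊗ₜ Coalgebra.comul a := rfl
    have ha3 : f2 k A (a ⊗ₜ 1) = a ⊗ₜ Coalgebra.comul 1 := rfl
    have ha4 : f1 k A (1 ⊗ₜ a) = TensorProduct.assoc k A A A (Coalgebra.comul 1 ⊗ₜ a) := rfl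
    have hf0 : ∀ c, f0 k A c = 1 ⊗ₜ c := fun _ => rfl
    change d2 k A (d1 k A a) = 0
    rw [d1_apply, map_sub, map_add, d2_apply, d2_apply, d2_apply, h12, ha1, ha2, ha3, ha4, h3, h3,
      h3, hf0, hf0, hf0, Bialgebra.comul_one, Algebra.TensorProduct.one_def,
      TensorProduct.assoc_tmul, TensorProduct.assoc_tmul, TensorProduct.assoc_tmul]
    abel

variable (k A) in
/-- The second cohomology of the cobar complex. -/
abbrev H2 : Type _ := Z2 k A ⧸ (B2 k A).submoduleOf (Z2 k A)

end Complex

section Operator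

variable {p : ℕ} [Fact p.Prime] {k A : Type*} [Field k] [CharP k p] [CommRing A] [Bialgebra k A]

/-- The action of a primitive element on `A ⊗ A`: `a ⊗ b ↦ δ(a) ⊗ b + a ⊗ δ(b)`. -/
def tensorDer (δ : A →ₗ[k] A) : A ⊗[k] A →ₗ[k] A ⊗[k] A := δ.rTensor A + δ.lTensor A

variable (p) in
/-- `Φ(χ) = χ ^ p + c χ + δ ^ (p - 1) (χ)`. -/
def phi (δ : A →ₗ[k] A) (c : k) (χ : A ⊗[k] A) : A ⊗[k] A :=
  χ ^ p + c • χ + (tensorDer δ ^ (p - 1)) χ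

variable (p k) in
theorem add_pow_char' {R : Type*} [CommRing R] [Algebra k R] (x y : R) :
    (x + y) ^ p = x ^ p + y ^ p :=
  RestrictedEnveloping.add_pow_char_of_commute' Fact.out k (Commute.all x y)

variable (p k) in
theorem sub_pow_char' {R : Type*} [CommRing R] [Algebra k R] (x y : R) :
    (x - y) ^ p = x ^ p - y ^ p := by
  rw [eq_sub_iff_add_eq, ← add_pow_char' p k, sub_add_cancel]

theorem phi_add (δ : A →ₗ[k] A) (c : k) (x y : A ⊗[k] A) :
    phi p δ c (x + y) = phi p δ c x + phi p δ c y := by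
  simp only [phi, add_pow_char' p k, smul_add, map_add]
  abel

/-- A derivation of `A` that is compatible with the comultiplication and the counit. -/
structure IsCoder (δ : Derivation k A A) : Prop where
  counit : ∀ a, Coalgebra.counit (R := k) (δ a) = 0
  comul : ∀ a, Coalgebra.comul (R := k) (δ a) = tensorDer (δ : A →ₗ[k] A) (Coalgebra.comul a)

variable {δ : Derivation k A A}

theorem tensorDer_mem (hδ : IsCoder δ) {x : A ⊗[k] A} (hx : x ∈ augSq k A) :
    tensorDer (δ : A →ₗ[k] A) x ∈ augSq k A := by
  refine augSq_induction (P := fun x => tensorDer (δ : A →ₗ[k] A) x ∈ augSq k A) hx (by simp)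
    (fun a ha b hb => ?_) (fun u v hu hv => ?_)
  · exact add_mem (tmul_mem_augSq (mem_aug.mpr (hδ.counit a)) hb)
      (tmul_mem_augSq ha (mem_aug.mpr (hδ.counit b)))
  · rw [map_add]; exact add_mem hu hv

theorem d1_tensorDer (hδ : IsCoder δ) (a : A) :
    tensorDer (δ : A →ₗ[k] A) (d1 k A a) = d1 k A (δ a) := by
  rw [d1_apply, d1_apply, hδ.comul]
  simp [tensorDer]
  abel

theorem d2_tensorDer (hδ : IsCoder δ) (c : A ⊗[k] A) :
    d2 k A (tensorDer (δ : A →ₗ[k] A) c) =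
      (δ : A →ₗ[k] A).rTensor (A ⊗[k] A) (d2 k A c) +
        (tensorDer (δ : A →ₗ[k] A)).lTensor A (d2 k A c) := by
  have key : ∀ (t : A ⊗[k] A) (b : A),
      (δ : A →ₗ[k] A).rTensor (A ⊗[k] A) (TensorProduct.assoc k A A A (t ⊗ₜ b)) +
        (tensorDer (δ : A →ₗ[k] A)).lTensor A (TensorProduct.assoc k A A A (t ⊗ₜ b)) =
      TensorProduct.assoc k A A A (tensorDer (δ : A →ₗ[k] A) t ⊗ₜ b + t ⊗ₜ δ b) := fun t b => by
    induction t with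
    | zero => simp
    | tmul x y =>
      simp [tensorDer, TensorProduct.add_tmul]
      abel
    | add x y hx hy =>
      simp only [TensorProduct.add_tmul, map_add] at hx hy ⊢
      rw [add_add_add_comm, hx, hy]
      abel
  induction c with
  | zero => simp
  | tmul a b =>
    have h0 : ∀ c, f0 k A c = 1 ⊗ₜ c := fun _ => rfl
    have h1 : ∀ a b, f1 k A (a ⊗ₜ b) = TensorProduct.assoc k A A A (Coalgebra.comul a ⊗ₜ b) :=
      fun _ _ => rfl
    have h2 : ∀ a b, f2 k A (a ⊗ₜ b) = a ⊗ₜ Coalgebra.comul b := fun _ _ => rfl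
    have h3 : ∀ a b, f3 k A (a ⊗ₜ b) = a ⊗ₜ (b ⊗ₜ 1) := fun _ _ => rfl
    have k1 := key (Coalgebra.comul a) b
    have ht : tensorDer (δ : A →ₗ[k] A) (a ⊗ₜ b) = δ a ⊗ₜ b + a ⊗ₜ δ b := rfl
    have hs : tensorDer (δ : A →ₗ[k] A) (b ⊗ₜ 1) = δ b ⊗ₜ 1 := by simp [tensorDer]
    rw [ht, map_add, d2_apply, d2_apply, d2_apply]
    simp only [h0, h1, h2, h3, map_add, map_sub, LinearMap.rTensor_tmul, LinearMap.lTensor_tmul,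
      hδ.comul, ht, hs, TensorProduct.tmul_add, Derivation.coeFn_coe, Derivation.map_one_eq_zero,
      TensorProduct.zero_tmul] at k1 ⊢
    linear_combination k1
  | add x y hx hy => simp only [map_add, hx, hy]; abel

theorem phi_mem_Z2 (hδ : IsCoder δ) (c : k) {x : A ⊗[k] A} (hx : x ∈ Z2 k A) :
    phi p (δ : A →ₗ[k] A) c x ∈ Z2 k A := by
  refine add_mem (add_mem ⟨pow_mem_augSq hx.1 (Fact.out : p.Prime).ne_zero, ?_⟩
    (Submodule.smul_mem _ c hx)) ?_
  · have h := hx.2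
    change d2 k A _ = 0 at h
    change d2 k A _ = 0
    rw [d2_apply] at h ⊢
    simp only [map_pow]
    rw [← sub_pow_char' p k, ← add_pow_char' p k, ← sub_pow_char' p k, h,
      zero_pow (Fact.out : p.Prime).ne_zero]
  · generalize p - 1 = n
    induction n with
    | zero => simpa using hx
    | succ n ih =>
      rw [pow_succ', Module.End.mul_apply]
      refine ⟨tensorDer_mem hδ ih.1, ?_⟩
      have h : d2 k A _ = 0 := ih.2
      change d2 k A _ = 0
      rw [d2_tensorDer hδ, h, map_zero, map_zero, add_zero]

theorem phi_mem_B2 (hδ : IsCoder δ) (c : k) {x : A ⊗[k] A} (hx : x ∈ B2 k A) :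
    phi p (δ : A →ₗ[k] A) c x ∈ B2 k A := by
  obtain ⟨a, ha, rfl⟩ := hx
  have ha' : Coalgebra.counit (R := k) a = 0 := ha
  refine add_mem (add_mem ⟨a ^ p, ?_, ?_⟩ (Submodule.smul_mem _ c ⟨a, ha, rfl⟩)) ?_
  · simp [mem_aug, ha', (Fact.out : p.Prime).ne_zero]
  · rw [d1_apply, d1_apply, sub_pow_char' p k, add_pow_char' p k, Bialgebra.comul_pow,
      Algebra.TensorProduct.tmul_pow, Algebra.TensorProduct.tmul_pow, one_pow]
  · generalize p - 1 = n
    induction n with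
    | zero => exact ⟨a, ha, rfl⟩
    | succ n ih =>
      rw [pow_succ', Module.End.mul_apply]
      obtain ⟨b, hb, h⟩ := ih
      rw [← h, d1_tensorDer hδ]
      exact ⟨δ b, mem_aug.mpr (hδ.counit b), rfl⟩

variable (p) in
/-- The operator `Φ` on the second cohomology of the cobar complex. -/
def phiH2 (hδ : IsCoder δ) (c : k) : H2 k A →+ H2 k A :=
  QuotientAddGroup.map _ _
    { toFun := fun x => (⟨phi p (δ : A →ₗ[k] A) c x, phi_mem_Z2 hδ c x.2⟩ : Z2 k A)
      map_zero' := by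
        apply Subtype.ext
        have := phi_add (p := p) (δ : A →ₗ[k] A) c 0 0
        rw [add_zero] at this
        exact left_eq_add.mp this
      map_add' := fun x y => Subtype.ext (phi_add _ c _ _) }
    (fun x hx => phi_mem_B2 (p := p) hδ c hx)

theorem phiH2_mk (hδ : IsCoder δ) (c : k) (x : Z2 k A) :
    phiH2 p hδ c (Submodule.Quotient.mk x) =
      Submodule.Quotient.mk ⟨phi p (δ : A →ₗ[k] A) c x, phi_mem_Z2 hδ c x.2⟩ := rfl

end Operator

section Omega

/-- The cocycle identity for `∑_{0 < i < p} ((p choose i) / p) a ^ i b ^ (p - i)`. -/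
theorem omega_cocycle (p : ℕ) (hp : p.Prime) (R : Type*) [CommRing R] (a b c : R) :
    (∑ i ∈ Finset.Ioo 0 p, ((p.choose i / p : ℕ) : R) * (b ^ i * c ^ (p - i))) -
    (∑ i ∈ Finset.Ioo 0 p, ((p.choose i / p : ℕ) : R) * ((a + b) ^ i * c ^ (p - i))) +
    (∑ i ∈ Finset.Ioo 0 p, ((p.choose i / p : ℕ) : R) * (a ^ i * (b + c) ^ (p - i))) -
    (∑ i ∈ Finset.Ioo 0 p, ((p.choose i / p : ℕ) : R) * (a ^ i * b ^ (p - i))) = 0 := by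
  have main : ∀ x y z : MvPolynomial (Fin 3) ℤ,
    (∑ i ∈ Finset.Ioo 0 p, ((p.choose i / p : ℕ) : MvPolynomial (Fin 3) ℤ) *
      (y ^ i * z ^ (p - i))) -
    (∑ i ∈ Finset.Ioo 0 p, ((p.choose i / p : ℕ) : MvPolynomial (Fin 3) ℤ) *
      ((x + y) ^ i * z ^ (p - i))) +
    (∑ i ∈ Finset.Ioo 0 p, ((p.choose i / p : ℕ) : MvPolynomial (Fin 3) ℤ) *
      (x ^ i * (y + z) ^ (p - i))) -
    (∑ i ∈ Finset.Ioo 0 p, ((p.choose i / p : ℕ) : MvPolynomial (Fin 3) ℤ) *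
      (x ^ i * y ^ (p - i))) = 0 := by
    intro x y z
    have e : ∀ u v : MvPolynomial (Fin 3) ℤ, (p : MvPolynomial (Fin 3) ℤ) *
        (∑ i ∈ Finset.Ioo 0 p, ((p.choose i / p : ℕ) : MvPolynomial (Fin 3) ℤ) *
          (u ^ i * v ^ (p - i))) = (u + v) ^ p - u ^ p - v ^ p := fun u v => by
      have h := add_pow_prime_eq' hp u v
      rw [h]
      simp only [mul_comm (((_ : ℕ) : MvPolynomial (Fin 3) ℤ)) (u ^ _ * _)]
      ring
    have hp0 : (p : MvPolynomial (Fin 3) ℤ) ≠ 0 := Nat.cast_ne_zero.mpr hp.ne_zero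
    refine (mul_eq_zero.mp ?_).resolve_left hp0
    rw [mul_sub, mul_add, mul_sub, e, e, e, e, add_assoc x y z]
    ring
  have := congrArg (MvPolynomial.aeval (R := ℤ) ![a, b, c])
    (main (MvPolynomial.X 0) (MvPolynomial.X 1) (MvPolynomial.X 2))
  simpa using this

variable (p : ℕ) [Fact p.Prime] (k : Type*) {A : Type*} [Field k] [CommRing A] [Bialgebra k A]

/-- `ω(x) = ∑_{0 < i < p} ((p choose i) / p) x ^ i ⊗ x ^ (p - i)`. -/
def omega (x : A) : A ⊗[k] A :=
  ∑ i ∈ Finset.Ioo 0 p, ((p.choose i / p : ℕ) : k) • ((x ^ i) ⊗ₜ[k] (x ^ (p - i)))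

theorem omega_mem_Z2 {x : A} (hε : Coalgebra.counit (R := k) x = 0)
    (hΔ : Coalgebra.comul (R := k) x = x ⊗ₜ[k] 1 + 1 ⊗ₜ[k] x) : omega p k x ∈ Z2 k A := by
  refine ⟨?_, ?_⟩
  · refine Submodule.sum_mem _ fun i hi => Submodule.smul_mem _ _ ?_
    rw [Finset.mem_Ioo] at hi
    exact tmul_mem_augSq (by simp [mem_aug, hε, hi.1.ne']) (by
      simp [mem_aug, hε, (Nat.sub_pos_of_lt hi.2).ne'])
  · have e : omega p k x = ∑ i ∈ Finset.Ioo 0 p, ((p.choose i / p : ℕ) : A ⊗[k] A) *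
        ((x ⊗ₜ[k] 1) ^ i * (1 ⊗ₜ[k] x) ^ (p - i)) := by
      refine Finset.sum_congr rfl fun i _ => ?_
      rw [Algebra.smul_def, map_natCast, Algebra.TensorProduct.tmul_pow,
        Algebra.TensorProduct.tmul_pow, Algebra.TensorProduct.tmul_mul_tmul, one_pow, one_pow,
        one_mul, mul_one]
    have := omega_cocycle p Fact.out (A ⊗[k] (A ⊗[k] A)) (x ⊗ₜ (1 ⊗ₜ 1)) (1 ⊗ₜ (x ⊗ₜ 1))
      (1 ⊗ₜ (1 ⊗ₜ x))
    have g01 : f0 k A (x ⊗ₜ 1) = 1 ⊗ₜ (x ⊗ₜ 1) := rfl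
    have g02 : f0 k A (1 ⊗ₜ x) = 1 ⊗ₜ (1 ⊗ₜ x) := rfl
    have g11 : f1 k A (x ⊗ₜ 1) = x ⊗ₜ (1 ⊗ₜ 1) + 1 ⊗ₜ (x ⊗ₜ 1) := by
      change TensorProduct.assoc k A A A (Coalgebra.comul x ⊗ₜ 1) = _
      rw [hΔ, TensorProduct.add_tmul, map_add, TensorProduct.assoc_tmul, TensorProduct.assoc_tmul]
    have g12 : f1 k A (1 ⊗ₜ x) = 1 ⊗ₜ (1 ⊗ₜ x) := by
      change TensorProduct.assoc k A A A (Coalgebra.comul 1 ⊗ₜ x) = _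
      rw [Bialgebra.comul_one]; rfl
    have g21 : f2 k A (x ⊗ₜ 1) = x ⊗ₜ (1 ⊗ₜ 1) := by
      change x ⊗ₜ Coalgebra.comul 1 = _
      rw [Bialgebra.comul_one]; rfl
    have g22 : f2 k A (1 ⊗ₜ x) = 1 ⊗ₜ (x ⊗ₜ 1) + 1 ⊗ₜ (1 ⊗ₜ x) := by
      change 1 ⊗ₜ Coalgebra.comul x = _
      rw [hΔ, TensorProduct.tmul_add]
    have g31 : f3 k A (x ⊗ₜ 1) = x ⊗ₜ (1 ⊗ₜ 1) := rfl
    have g32 : f3 k A (1 ⊗ₜ x) = 1 ⊗ₜ (x ⊗ₜ 1) := rfl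
    change d2 k A _ = 0
    rw [d2_apply, e]
    simp only [map_sum, map_mul, map_natCast, map_pow, g01, g02, g11, g12, g21, g22, g31, g32]
    exact this

end Omega

end Cobar

namespace AlgebraicRepresentation

variable {p : ℕ} {k 𝔤 𝔥 : Type*} [Field k] [LieRing 𝔤] [LieAlgebra k 𝔤]
    [RestrictedLieAlgebra p k 𝔤] [LieRing 𝔥] [LieAlgebra k 𝔥] [RestrictedLieAlgebra p k 𝔥]
    [IsLieAbelian 𝔥]

theorem apply_pMap_eq_zero [Fact p.Prime] (ρ : AlgebraicRepresentation p k 𝔤 𝔥) (z : 𝔤) (x : 𝔥) :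
    ρ.toLin z (RestrictedLieAlgebra.pMap p k x) = 0 := by
  have h : LieAlgebra.ad k 𝔥 x = 0 := by
    ext y
    exact trivial_lie_zero 𝔥 𝔥 x y
  rw [ρ.apply_pMap, h, zero_pow (Nat.sub_pos_of_lt (Fact.out : p.Prime).one_lt).ne',
    LinearMap.zero_apply]

variable [Fact p.Prime] [CharP k p]

/-- The action `ρ_z` of `z ∈ 𝔤` on `u(𝔥)`: the derivation that extends `ρ_z : 𝔥 → 𝔥`. -/
def act (ρ : AlgebraicRepresentation p k 𝔤 𝔥) (z : 𝔤) :
    Derivation k (RestrictedEnveloping p k 𝔥) (RestrictedEnveloping p k 𝔥) :=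
  RestrictedEnveloping.derivation p k 𝔥 (ρ.toLin z) (ρ.apply_pMap_eq_zero z)

theorem act_ι (ρ : AlgebraicRepresentation p k 𝔤 𝔥) (z : 𝔤) (x : 𝔥) :
    ρ.act z (RestrictedEnveloping.ι p k 𝔥 x) = RestrictedEnveloping.ι p k 𝔥 (ρ.toLin z x) :=
  RestrictedEnveloping.derivation_ι _ _ _ _ _ x

theorem isCoder_act (ρ : AlgebraicRepresentation p k 𝔤 𝔥) (z : 𝔤) :
    Cobar.IsCoder (ρ.act z) where
  counit a := by
    let S : Subalgebra k (RestrictedEnveloping p k 𝔥) :=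
      { carrier := {a | Coalgebra.counit (R := k) (ρ.act z a) = 0}
        mul_mem' := fun {a b} ha hb => by
          simp only [Set.mem_ofPred_eq] at ha hb ⊢
          simp [ha, hb]
        add_mem' := fun {a b} ha hb => by
          simp only [Set.mem_ofPred_eq] at ha hb ⊢
          simp [ha, hb]
        algebraMap_mem' := fun r => by simp }
    exact RestrictedEnveloping.mem_of_ι_mem S (fun x => by
      change Coalgebra.counit (R := k) (ρ.act z _) = 0
      rw [act_ι]
      exact RestrictedEnveloping.counitHom_ι p k _) a
  comul a := by
    let D := Cobar.tensorDer (ρ.act z : RestrictedEnveloping p k 𝔥 →ₗ[k] _)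
    have hD : ∀ s t, D (s * t) = s * D t + D s * t := fun s t => by
      induction s with
      | zero => simp
      | tmul a b =>
        induction t with
        | zero => simp
        | tmul c d =>
          simp [D, Cobar.tensorDer, mul_add, TensorProduct.add_tmul,
            TensorProduct.tmul_add, mul_comm]
          abel
        | add x y hx hy => simp only [mul_add, map_add, hx, hy]; abel
      | add x y hx hy => simp only [add_mul, map_add, hx, hy]; abel
    let S : Subalgebra k (RestrictedEnveloping p k 𝔥) :=
      { carrier := {a | Coalgebra.comul (R := k) (ρ.act z a) = D (Coalgebra.comul a)}
        mul_mem' := fun {a b} ha hb => by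
          simp only [Set.mem_ofPred_eq] at ha hb ⊢
          simp [ha, hb, hD, mul_comm]
        add_mem' := fun {a b} ha hb => by
          simp only [Set.mem_ofPred_eq] at ha hb ⊢
          simp [ha, hb]
        algebraMap_mem' := fun r => by
          simp [D, Cobar.tensorDer, Algebra.TensorProduct.algebraMap_apply] }
    exact RestrictedEnveloping.mem_of_ι_mem S (fun x => by
      change Coalgebra.comul (R := k) (ρ.act z _) = D _
      rw [act_ι]
      refine (RestrictedEnveloping.comulHom_ι p k _).trans ?_
      refine Eq.trans ?_ (congrArg D (RestrictedEnveloping.comulHom_ι p k x)).symm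
      simp [D, Cobar.tensorDer, act_ι]) a

/-- The `z`-operator `Φ_z(ξ) = ξ ^ p + c ξ + ρ_z ^ (p - 1) (ξ)` on `H²(Ω u(𝔥))`, for `z ∈ 𝔤` with
`z^[p] + c z = 0`. -/
def zOperator (ρ : AlgebraicRepresentation p k 𝔤 𝔥) (z : 𝔤) (c : k) :
    Cobar.H2 k (RestrictedEnveloping p k 𝔥) →+ Cobar.H2 k (RestrictedEnveloping p k 𝔥) :=
  Cobar.phiH2 p (ρ.isCoder_act z) c

/-- `ξ ∈ H²(Ω u(𝔥))` is `z`-characteristic if `Φ_z(ξ) = 0`. -/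
def IsZCharacteristic (ρ : AlgebraicRepresentation p k 𝔤 𝔥) (z : 𝔤) (c : k)
    (ξ : Cobar.H2 k (RestrictedEnveloping p k 𝔥)) : Prop :=
  ρ.zOperator z c ξ = 0

end AlgebraicRepresentation

section Classes

variable (p : ℕ) [Fact p.Prime] (k : Type*) {𝔥 : Type*} [Field k] [CharP k p] [LieRing 𝔥]
    [LieAlgebra k 𝔥] [RestrictedLieAlgebra p k 𝔥] [IsLieAbelian 𝔥]

theorem ι_tmul_ι_mem_Z2 (x y : 𝔥) :
    RestrictedEnveloping.ι p k 𝔥 x ⊗ₜ[k] RestrictedEnveloping.ι p k 𝔥 y ∈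
      Cobar.Z2 k (RestrictedEnveloping p k 𝔥) := by
  have h : ∀ x : 𝔥, Cobar.redComul k (RestrictedEnveloping p k 𝔥)
      (RestrictedEnveloping.ι p k 𝔥 x) = 0 := fun x => by
    have := RestrictedEnveloping.comulHom_ι p k x
    change Coalgebra.comul (R := k) (RestrictedEnveloping.ι p k 𝔥 x) = _ at this
    simp [Cobar.redComul, this]
  refine ⟨Cobar.tmul_mem_augSq (RestrictedEnveloping.counitHom_ι p k x)
    (RestrictedEnveloping.counitHom_ι p k y), ?_⟩
  change Cobar.d2 _ _ _ = 0
  simp [Cobar.d2, h]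

/-- The product `x ∧ y = [x ⊗ y] ∈ H²(Ω u(𝔥))` of two elements of `H¹(Ω u(𝔥)) = 𝔥`. -/
def wedgeClass (x y : 𝔥) : Cobar.H2 k (RestrictedEnveloping p k 𝔥) :=
  Submodule.Quotient.mk ⟨_, ι_tmul_ι_mem_Z2 p k x y⟩

/-- The class `ω(x) = [∑_{0 < i < p} ((p choose i) / p) x ^ i ⊗ x ^ (p - i)] ∈ H²(Ω u(𝔥))` of
`x ∈ 𝔥`. -/
def omegaClass (x : 𝔥) : Cobar.H2 k (RestrictedEnveloping p k 𝔥) :=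
  Submodule.Quotient.mk ⟨Cobar.omega p k (RestrictedEnveloping.ι p k 𝔥 x),
    Cobar.omega_mem_Z2 p k (RestrictedEnveloping.counitHom_ι p k x)
      (RestrictedEnveloping.comulHom_ι p k x)⟩

end Classes

end

/-! Write $\lambda$ for `lam` and $\lambda^{1/p}$ for its $p$-th root. The operator $\Phi_z$ is
additive, so it can be computed on each summand of $\xi$.

On $\mu\,a\wedge b$ it gives again a combination of wedge classes: the $p$-th power produces
$\mu^p\,a^p\wedge b^p$, and $\rho_z^{p-1}$ expands binomially because $\rho_z\otimes1$ and
$1\otimes\rho_z$ commute. On $\omega(y)$ it gives $\omega(y^p+\lambda^{1/p}y)$: the coefficients of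
$\omega$ lie in the prime field, $\omega$ is additive up to coboundaries with
$\omega(ry)=r^p\omega(y)$, and $\rho_z\,\omega(y)$ is a coboundary (`zOperator_exteriorClass`,
`zOperator_omegaClass`).

Hence $\Phi_z(\xi)$ is the image of a pair $(T,w)\in\Lambda^2(\mathfrak h)\times\mathfrak h$ under
$(T,w)\mapsto T+\omega(w)$, and the theorem says that this map has trivial kernel
(`exteriorClass_add_omegaClass_eq_zero_iff`). Coboundaries and $\omega(w)$ are symmetric under the
swap of factors, which forces $T=-T$, so $T=0$ as $p\neq2$. If $\omega(w)$ is a coboundary, pairing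
it with $f\otimes f^{p-1}$, for a functional $f$ with $f(1)=0$ and hence $f^p=0$ in the dual
algebra, gives $(p-1)!\,f(w)^p=0$, so $w=0$ (`eq_zero_of_omega_mem_B2`).

Both steps need $\mathfrak h\to u(\mathfrak h)$ to be injective (`ι_injective`). This is shown
without a PBW basis: each functional on $\mathfrak h$ is detected by an algebra map from
$u(\mathfrak h)$ to a quotient of a Hahn series ring. -/

noncomputable section

/-! ### Semilinearity of the $p$-map in the abelian case -/

namespace RestrictedLieAlgebra

variable {p : ℕ} [Fact p.Prime] {k L : Type*} [Field k] [LieRing L] [LieAlgebra k L]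
  [RestrictedLieAlgebra p k L] [IsLieAbelian L]

theorem jacobsonS_eq_zero_of_abelian (hp : 2 < p) (i : ℕ) (a b : L) : jacobsonS p k i a b = 0 := by
  have h : ∀ x : L, LieAlgebra.ad k L x = 0 := fun x => by
    ext y
    exact trivial_lie_zero L L x y
  rw [jacobsonS, h, h, map_zero, mul_zero, add_zero, zero_pow (by omega), Polynomial.coeff_zero,
    LinearMap.zero_apply, smul_zero]

theorem pMap_add_of_abelian (hp : 2 < p) (x y : L) :
    pMap p k (x + y) = pMap p k x + pMap p k y := by
  rw [pMap_add, Finset.sum_eq_zero fun i _ => jacobsonS_eq_zero_of_abelian hp i x y, add_zero]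

theorem pMap_iterate_add (hp : 2 < p) (m : ℕ) (x y : L) :
    (pMap p k)^[m] (x + y) = (pMap p k)^[m] x + (pMap p k)^[m] y := by
  induction m with
  | zero => rfl
  | succ m ih => simp only [Function.iterate_succ_apply', ih, pMap_add_of_abelian hp]

theorem pMap_iterate_smul (m : ℕ) (c : k) (x : L) :
    (pMap p k)^[m] (c • x) = c ^ p ^ m • (pMap p k)^[m] x := by
  induction m with
  | zero => simp
  | succ m ih => simp only [Function.iterate_succ_apply', ih, pMap_smul, ← pow_mul, ← pow_succ]

end RestrictedLieAlgebra

/-! ### Hahn series with exponents $p^{-m}$ and their $p$-th powers -/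

namespace InverseFrobeniusSeries

open HahnSeries OrderDual

/-- The exponents `p ^ (-(m + N))`, `m ∈ ℕ`, in decreasing order. -/
def expEmb (p : ℕ) [hp : Fact p.Prime] (N : ℕ) : ℕ ↪o ℚ≥0ᵒᵈ :=
  OrderEmbedding.ofStrictMono (fun m => toDual (((p : ℚ≥0)⁻¹) ^ (m + N))) fun a b hab =>
    toDual_lt_toDual.mpr (pow_lt_pow_right_of_lt_one₀
      (inv_pos.mpr (Nat.cast_pos.mpr hp.out.pos))
      (inv_lt_one_of_one_lt₀ (Nat.one_lt_cast.mpr hp.out.one_lt)) (by omega))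

variable {p : ℕ} [Fact p.Prime] {k : Type*} [Field k]

theorem expEmb_succ (N m : ℕ) : expEmb p N (m + 1) = expEmb p (N + 1) m := by
  change toDual _ = toDual _
  congr 2
  ring

theorem nsmul_expEmb_succ (N : ℕ) : p • expEmb p (N + 1) 0 = expEmb p N 0 := by
  have hp : (p : ℚ≥0) ≠ 0 := Nat.cast_ne_zero.mpr (Fact.out : p.Prime).ne_zero
  change toDual (p • ((p : ℚ≥0)⁻¹ ^ (0 + (N + 1)))) = toDual _
  congr 1
  rw [nsmul_eq_mul, ← add_assoc, pow_succ', mul_inv_cancel_left₀ hp]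

/-- The series `∑ a m t ^ (p ^ (-(m + N)))`. -/
def series (p : ℕ) [Fact p.Prime] (N : ℕ) (a : ℕ → k) : HahnSeries ℚ≥0ᵒᵈ k :=
  -- The exponents decrease towards 0, so the support is well-ordered only for the dual order on
  -- `ℚ≥0`.
  embDomain (expEmb p N) ⟨a, Set.isPWO_of_wellQuasiOrderedLE _⟩

theorem series_coeff_expEmb (N : ℕ) (a : ℕ → k) (m : ℕ) :
    (series p N a).coeff (expEmb p N m) = a m := by
  rw [series, embDomain_coeff]

theorem series_coeff_of_notMem (N : ℕ) (a : ℕ → k) {e : ℚ≥0ᵒᵈ} (he : e ∉ Set.range (expEmb p N)) :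
    (series p N a).coeff e = 0 :=
  embDomain_of_notMem_range he

theorem series_add (N : ℕ) (a b : ℕ → k) : series p N (a + b) = series p N a + series p N b := by
  ext e
  by_cases he : e ∈ Set.range (expEmb p N)
  · obtain ⟨m, rfl⟩ := he
    simp [series_coeff_expEmb]
  · simp [series_coeff_of_notMem N _ he]

theorem series_smul (N : ℕ) (c : k) (a : ℕ → k) : series p N (c • a) = c • series p N a := by
  ext e
  by_cases he : e ∈ Set.range (expEmb p N)
  · obtain ⟨m, rfl⟩ := he
    simp [series_coeff_expEmb]
  · simp [series_coeff_of_notMem N _ he]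

theorem series_eq_single_add (N : ℕ) (a : ℕ → k) :
    series p N a = single (expEmb p N 0) (a 0) + series p (N + 1) (fun m => a (m + 1)) := by
  have h0 : expEmb p N 0 ∉ Set.range (expEmb p (N + 1)) := by
    rintro ⟨m, hm⟩
    rw [← expEmb_succ] at hm
    exact absurd ((expEmb p N).injective hm) (by omega)
  ext e
  by_cases he : e ∈ Set.range (expEmb p N)
  · obtain ⟨m, rfl⟩ := he
    cases m with
    | zero => simp [series_coeff_expEmb, series_coeff_of_notMem _ _ h0]
    | succ m =>
      rw [series_coeff_expEmb, coeff_add, coeff_single_of_ne, expEmb_succ, series_coeff_expEmb,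
        zero_add]
      exact fun h => absurd ((expEmb p N).injective h) (by omega)
  · rw [series_coeff_of_notMem _ _ he, coeff_add, coeff_single_of_ne, series_coeff_of_notMem,
      add_zero]
    · rintro ⟨m, rfl⟩
      exact he ⟨m + 1, expEmb_succ N m⟩
    · rintro rfl
      exact he ⟨0, rfl⟩

/-- All exponents of `x` lie in the interval `(0, u]`. -/
def ExponentsIn (u : ℚ≥0) (x : HahnSeries ℚ≥0ᵒᵈ k) : Prop :=
  ∀ e ∈ x.support, 0 < ofDual e ∧ ofDual e ≤ u

theorem ExponentsIn.mul {u v : ℚ≥0} {x y : HahnSeries ℚ≥0ᵒᵈ k} (hx : ExponentsIn u x)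
    (hy : ExponentsIn v y) : ExponentsIn (u + v) (x * y) := fun e he => by
  obtain ⟨a, ha, b, hb, rfl⟩ := support_mul_subset he
  exact ⟨add_pos (hx a ha).1 (hy b hb).1, add_le_add (hx a ha).2 (hy b hb).2⟩

theorem ExponentsIn.pow {u : ℚ≥0} {x : HahnSeries ℚ≥0ᵒᵈ k} (hx : ExponentsIn u x) (n : ℕ) :
    ExponentsIn ((n + 1 : ℕ) * u) (x ^ (n + 1)) := by
  induction n with
  | zero => simpa using hx
  | succ n ih =>
    rw [pow_succ]
    convert ih.mul hx using 1
    push_cast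
    ring

theorem exponentsIn_series (N : ℕ) (a : ℕ → k) :
    ExponentsIn ((p : ℚ≥0)⁻¹ ^ N) (series p N a) := fun e he => by
  have hp : (0 : ℚ≥0) < (p : ℚ≥0)⁻¹ := inv_pos.mpr (Nat.cast_pos.mpr (Fact.out : p.Prime).pos)
  by_cases h : e ∈ Set.range (expEmb p N)
  · obtain ⟨m, rfl⟩ := h
    exact ⟨pow_pos hp _, pow_le_pow_of_le_one hp.le
      (inv_le_one_of_one_le₀ (Nat.one_le_cast.mpr (Fact.out : p.Prime).one_le)) (by omega)⟩
  · exact absurd (series_coeff_of_notMem N a h) he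

/-- Raising to the $p$-th power multiplies each exponent $p^{-m}$ by $p$, but additivity of
Frobenius covers only finitely many terms. The difference of the two sides is therefore rewritten by
removing equal leading terms: for every $N$ it equals a difference of tails with exponents in
$(0,p^{-N}]$. No exponent satisfies this for all $N$. -/
theorem series_pow [CharP k p] (a : ℕ → k) :
    series p 0 a ^ p = single (toDual (p : ℚ≥0)) (a 0 ^ p) +
      series p 0 (fun m => a (m + 1) ^ p) := by
  have hp : p.Prime := Fact.out
  have step : ∀ (N : ℕ) (a : ℕ → k), series p N a ^ p - single (p • expEmb p N 0) (a 0 ^ p) =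
      series p (N + 1) (fun m => a (m + 1)) ^ p := fun N a => by
    rw [series_eq_single_add, Cobar.add_pow_char' p k, single_pow, add_sub_cancel_left]
  have key : ∀ (N : ℕ), series p 0 a ^ p - single (p • expEmb p 0 0) (a 0 ^ p) -
      series p 0 (fun m => a (m + 1) ^ p) = series p (N + 1) (fun m => a (m + N + 1)) ^ p -
      series p N (fun m => a (m + N + 1) ^ p) := fun N => by
    induction N with
    | zero => rw [step]
    | succ N ih =>
      rw [ih, series_eq_single_add N, ← sub_sub, ← nsmul_expEmb_succ N]
      have h := step (N + 1) (fun m => a (m + N + 1))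
      have e : ∀ m, m + 1 + N + 1 = m + (N + 1) + 1 := fun m => by omega
      simp only [e] at h ⊢
      rw [h]
  have e0 : p • expEmb p 0 0 = toDual (p : ℚ≥0) := by
    change toDual (p • ((p : ℚ≥0)⁻¹ ^ 0)) = _
    simp
  rw [← sub_eq_zero, ← sub_sub, ← e0]
  ext e
  by_contra hne
  have pos : ∀ N, 0 < ofDual e ∧ ofDual e ≤ (p : ℚ≥0)⁻¹ ^ N := fun N => by
    rw [key N, coeff_sub, coeff_zero] at hne
    by_cases h1 : (series p (N + 1) (fun m => a (m + N + 1)) ^ p).coeff e = 0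
    · rw [h1, zero_sub, neg_eq_zero] at hne
      exact exponentsIn_series N _ e hne
    · have := (exponentsIn_series (p := p) (N + 1) (fun m => a (m + N + 1))).pow (p - 1)
      rw [Nat.sub_add_cancel hp.one_le] at this
      have := this e h1
      rwa [pow_succ', mul_inv_cancel_left₀ (Nat.cast_ne_zero.mpr hp.ne_zero)] at this
  obtain ⟨N, hN⟩ := exists_pow_lt_of_lt_one (pos 0).1
    (inv_lt_one_of_one_lt₀ (Nat.one_lt_cast.mpr hp.one_lt) : (p : ℚ≥0)⁻¹ < 1)
  exact absurd (pos N).2 (not_le.mpr hN)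

end InverseFrobeniusSeries

/-! ### Injectivity of $L\to u(L)$ -/

namespace RestrictedEnveloping

open HahnSeries OrderDual InverseFrobeniusSeries RestrictedLieAlgebra

variable {p : ℕ} [Fact p.Prime] {k L : Type*} [Field k] [CharP k p] [PerfectRing k p] [LieRing L]
  [LieAlgebra k L] [RestrictedLieAlgebra p k L] [IsLieAbelian L]

/-- The linear map `x ↦ ∑ f(x^[p]^m) ^ (1 / p ^ m) t ^ (1 / p ^ m)`. -/
def frobeniusSeries (hp : 2 < p) (f : L →ₗ[k] k) : L →ₗ[k] HahnSeries ℚ≥0ᵒᵈ k where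
  toFun x := series p 0 fun m => (frobeniusEquiv k p).symm^[m] (f ((pMap p k)^[m] x))
  map_add' x y := by
    rw [← series_add]
    congr 1
    ext m
    rw [pMap_iterate_add hp, map_add, iterate_map_add, Pi.add_apply]
  map_smul' c x := by
    rw [RingHom.id_apply, ← series_smul]
    congr 1
    ext m
    rw [pMap_iterate_smul, map_smul, smul_eq_mul, iterate_map_mul, Pi.smul_apply, smul_eq_mul]
    congr 1
    induction m with
    | zero => simp
    | succ m ih =>
      rw [Function.iterate_succ_apply, pow_succ, pow_mul, frobeniusEquiv_symm_pow, ih]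

theorem frobeniusSeries_pow (hp : 2 < p) (f : L →ₗ[k] k) (x : L) :
    frobeniusSeries hp f x ^ p = single (OrderDual.toDual (p : ℚ≥0)) (f x ^ p) +
      frobeniusSeries hp f (pMap p k x) := by
  refine (series_pow _).trans ?_
  congr 2
  ext m
  rw [Function.iterate_succ_apply', Function.iterate_succ_apply, frobeniusEquiv_symm_pow_p]

/-- `L → u(L)` is injective, for abelian `L`. -/
theorem ι_injective (hp : 2 < p) : Function.Injective (ι p k L) := by
  rw [injective_iff_map_eq_zero]
  intro w hw
  rw [← Module.forall_dual_apply_eq_zero_iff k]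
  intro f
  let I : Ideal (HahnSeries ℚ≥0ᵒᵈ k) := Ideal.span {single (OrderDual.toDual (p : ℚ≥0)) 1}
  have hI : ∀ c, single (OrderDual.toDual (p : ℚ≥0)) c ∈ I := fun c => by
    have h := I.mul_mem_left (single 0 c) (Ideal.subset_span rfl)
    rwa [single_mul_single, zero_add, mul_one] at h
  -- By `frobeniusSeries_pow` the series of $x^{[p]}$ and the $p$-th power of the series of $x$
  -- differ by $f(x)^pt^p$, which vanishes modulo $t^p$.
  let g : RestrictedEnveloping p k L →ₐ[k] HahnSeries ℚ≥0ᵒᵈ k ⧸ I :=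
    lift ((Ideal.Quotient.mkₐ k I).toLinearMap ∘ₗ frobeniusSeries hp f)
      (fun x y => by rw [trivial_lie_zero, map_zero, mul_comm, sub_self])
      (fun x => by
        change Ideal.Quotient.mk I _ = Ideal.Quotient.mk I _ ^ p
        rw [← map_pow, frobeniusSeries_pow, map_add, Ideal.Quotient.eq_zero_iff_mem.mpr (hI _),
          zero_add])
  have h : g (ι p k L w) = Ideal.Quotient.mk I (frobeniusSeries hp f w) := lift_ι _ _ _ w
  rw [hw, map_zero, eq_comm, Ideal.Quotient.eq_zero_iff_mem, Ideal.mem_span_singleton'] at h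
  obtain ⟨a, ha⟩ := h
  -- The coefficient of $t^1$ is $f(w)$, while every multiple of $t^p$ has only exponents at least
  -- $p>1$.
  have h1 : (frobeniusSeries hp f w).coeff (expEmb p 0 0) = f w := series_coeff_expEmb _ _ 0
  rw [← h1, ← ha]
  by_contra hne
  obtain ⟨b, -, c, hc, hbc⟩ := support_mul_subset hne
  rw [eq_of_mem_support_single hc] at hbc
  have h2 : (ofDual b : ℚ≥0) + p = (p : ℚ≥0)⁻¹ ^ 0 := hbc
  have h3 : (p : ℚ≥0) ≤ 1 := by
    rw [pow_zero] at h2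
    rw [← h2]
    exact le_add_of_nonneg_left zero_le
  exact absurd h3 (not_le.mpr (Nat.one_lt_cast.mpr (by omega)))

end RestrictedEnveloping

/-! ### Detecting $\omega(w)$ by functionals on a cocommutative bialgebra -/

namespace Cobar

open WithConv

section Detection

variable {k A : Type*} [Field k] [CommRing A] [Bialgebra k A] [Coalgebra.IsCocomm k A]

/-- For primitive `w`, the derivation `f ↦ f(w ·)` of the convolution algebra of linear functionals
on `A`. -/
def mulDerivation {w : A} (hw : Coalgebra.comul (R := k) w = w ⊗ₜ[k] 1 + 1 ⊗ₜ[k] w) :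
    Derivation k (WithConv (A →ₗ[k] k)) (WithConv (A →ₗ[k] k)) :=
  Derivation.mk'
    { toFun := fun f => toConv (f.ofConv ∘ₗ LinearMap.mulLeft k w)
      map_add' := fun _ _ => rfl
      map_smul' := fun _ _ => rfl }
    (fun f g => by
      have key : ∀ t : A ⊗[k] A, TensorProduct.map f.ofConv g.ofConv ((w ⊗ₜ 1 + 1 ⊗ₜ w) * t) =
          TensorProduct.map f.ofConv (g.ofConv ∘ₗ LinearMap.mulLeft k w) t +
            TensorProduct.map (f.ofConv ∘ₗ LinearMap.mulLeft k w) g.ofConv t := fun t => by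
        induction t with
        | zero => simp
        | tmul a b => simp [add_mul, add_comm]
        | add x y hx hy => rw [mul_add, map_add, hx, hy, map_add, map_add]; abel
      rw [smul_eq_mul, smul_eq_mul, mul_comm g]
      ext a
      change (f * g).ofConv (w * a) = _
      rw [ofConv_add, LinearMap.add_apply, LinearMap.convMul_apply, LinearMap.convMul_apply,
        LinearMap.convMul_apply, Bialgebra.comul_mul, hw, key, map_add]
      rfl)

theorem mulDerivation_apply {w : A}
    (hw : Coalgebra.comul (R := k) w = w ⊗ₜ[k] 1 + 1 ⊗ₜ[k] w) (f : WithConv (A →ₗ[k] k)) (a : A) :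
    (mulDerivation hw f).ofConv a = f.ofConv (w * a) := rfl

theorem convMul_apply_one (f g : WithConv (A →ₗ[k] k)) :
    (f * g).ofConv 1 = f.ofConv 1 * g.ofConv 1 := by
  rw [LinearMap.convMul_apply, Bialgebra.comul_one, Algebra.TensorProduct.one_def]
  simp

theorem convPow_apply_one (f : WithConv (A →ₗ[k] k)) (n : ℕ) :
    (f ^ n).ofConv 1 = f.ofConv 1 ^ n := by
  induction n with
  | zero => simp [LinearMap.convOne_def]
  | succ n ih => rw [pow_succ, convMul_apply_one, ih, pow_succ]

/-- The values of `u f ^ m` on the powers `w ^ j`, `j ≤ m`, of a primitive element, for `f 1 = 0`. -/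
theorem convMul_pow_apply_pow {w : A} (hw : Coalgebra.comul (R := k) w = w ⊗ₜ[k] 1 + 1 ⊗ₜ[k] w)
    (f : WithConv (A →ₗ[k] k)) (hf : f.ofConv 1 = 0) (j : ℕ) :
    ∀ (u : WithConv (A →ₗ[k] k)), (∀ m, j < m → (u * f ^ m).ofConv (w ^ j) = 0) ∧
      (u * f ^ j).ofConv (w ^ j) = j.factorial * u.ofConv 1 * f.ofConv w ^ j := by
  induction j with
  | zero =>
    refine fun u => ⟨fun m hm => ?_, by simp⟩
    rw [pow_zero, convMul_apply_one, convPow_apply_one, hf, zero_pow hm.ne', mul_zero]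
  | succ j ih =>
    intro u
    -- One factor $w$ is traded for the derivation $f\mapsto f(w\,\cdot)$. Leibniz lowers the power
    -- of $f$ by one and changes the cofactor, which is why `u` must be arbitrary in the induction.
    have step : ∀ m, (u * f ^ (m + 1)).ofConv (w ^ (j + 1)) =
        ((mulDerivation hw u * f + ((m + 1 : ℕ) : k) • (u * mulDerivation hw f)) *
          f ^ m).ofConv (w ^ j) := fun m => by
      rw [pow_succ' w, ← mulDerivation_apply hw, Derivation.leibniz, Derivation.leibniz_pow,
        Nat.add_sub_cancel]
      congr 2
      simp only [smul_eq_mul, Nat.cast_smul_eq_nsmul k, nsmul_eq_mul]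
      ring
    constructor
    · intro m hm
      obtain ⟨m, rfl⟩ := Nat.exists_eq_succ_of_ne_zero (Nat.ne_zero_of_lt hm)
      rw [step]
      exact (ih _).1 m (by omega)
    -- At 1 the new cofactor takes the value $(j+1)\,u(1)f(w)$; its other term contains $f(1)=0$.
    · rw [step, (ih _).2, ofConv_add, ofConv_smul, LinearMap.add_apply, LinearMap.smul_apply,
        convMul_apply_one, convMul_apply_one, hf, mulDerivation_apply hw f, mul_one, Nat.factorial_succ,
        smul_eq_mul]
      push_cast
      ring

/-- A functional `f ⊗ g` with `f 1 = g 1 = 0` and `f g = 0` kills the coboundaries. -/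
theorem map_d1_eq_zero (f g : WithConv (A →ₗ[k] k)) (hf : f.ofConv 1 = 0) (hg : g.ofConv 1 = 0)
    (hfg : f * g = 0) (a : A) :
    LinearMap.mul' k k (TensorProduct.map f.ofConv g.ofConv (d1 k A a)) = 0 := by
  have h : (f * g).ofConv a = 0 := by rw [hfg]; rfl
  rw [LinearMap.convMul_apply] at h
  rw [d1_apply, map_sub, map_sub, h]
  simp [hf, hg]

variable (p : ℕ) [Fact p.Prime]

/-- If `f ^ p = 0` in the convolution algebra for a functional `f` with `f 1 = 0`, then `f` vanishes
on every primitive element `w` for which `ω(w)` is a coboundary. -/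
theorem apply_eq_zero_of_omega_mem_B2 [CharP k p] (hp : 2 < p) {w : A}
    (hw : Coalgebra.comul (R := k) w = w ⊗ₜ[k] 1 + 1 ⊗ₜ[k] w) (h : omega p k w ∈ B2 k A)
    (f : WithConv (A →ₗ[k] k)) (hf : f.ofConv 1 = 0) (hfp : f ^ p = 0) : f.ofConv w = 0 := by
  obtain ⟨a, -, ha⟩ := h
  have hg : (f ^ (p - 1)).ofConv 1 = 0 := by
    rw [convPow_apply_one, hf, zero_pow (by omega)]
  have h0 := map_d1_eq_zero f (f ^ (p - 1)) hf hg
    (by rw [← pow_succ', Nat.sub_add_cancel (by omega), hfp]) a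
  -- Only $i=1$ contributes, since $f^{p-1}$ vanishes on $w^{p-i}$ for $i>1$. Its coefficient is
  -- $\binom p1/p=1$, so the pairing is $f(w)\cdot(p-1)!\,f(w)^{p-1}$.
  rw [ha, omega, map_sum, map_sum, Finset.sum_eq_single_of_mem 1 (by simp; omega)] at h0
  · have hv := (convMul_pow_apply_pow hw f hf (p - 1) 1).2
    have hfac : ((p - 1).factorial : k) ≠ 0 := by
      rw [Ne, CharP.cast_eq_zero_iff k p, (Fact.out : p.Prime).dvd_factorial]
      omega
    rw [Nat.choose_one_right, Nat.div_self (by omega), Nat.cast_one, one_smul, pow_one,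
      TensorProduct.map_tmul, LinearMap.mul'_apply] at h0
    rw [one_mul] at hv
    rw [hv, LinearMap.convOne_def] at h0
    by_contra hne
    simp [hne, hfac] at h0
  · intro i hi hi1
    have hv := (convMul_pow_apply_pow hw f hf (p - i) 1).1 (p - 1)
      (by rw [Finset.mem_Ioo] at hi; omega)
    rw [one_mul] at hv
    rw [map_smul, map_smul, TensorProduct.map_tmul, LinearMap.mul'_apply, hv, mul_zero, smul_zero]

end Detection

end Cobar

/-! ### The dual algebra of $u(L)$ and nontriviality of $\omega$ -/

namespace RestrictedEnveloping

variable {p : ℕ} [Fact p.Prime] {k L : Type*} [Field k] [CharP k p] [LieRing L]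
  [LieAlgebra k L] [RestrictedLieAlgebra p k L]

theorem comul_ι (x : L) : Coalgebra.comul (R := k) (ι p k L x) =
    ι p k L x ⊗ₜ[k] 1 + 1 ⊗ₜ[k] ι p k L x := comulHom_ι p k x

theorem counit_ι (x : L) : Coalgebra.counit (R := k) (ι p k L x) = 0 := counitHom_ι p k x

/-- Cocommutativity makes the convolution algebra of functionals commutative, as the derivation
argument requires, and makes coboundaries symmetric. -/
instance instIsCocomm : Coalgebra.IsCocomm k (RestrictedEnveloping p k L) where
  comm_comp_comul := by
    have h : ((Algebra.TensorProduct.comm k (RestrictedEnveloping p k L)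
        (RestrictedEnveloping p k L)).toAlgHom.comp (comulHom p k L)) = comulHom p k L :=
      hom_ext fun x => by simp [comulHom_ι, add_comm]
    ext a
    exact DFunLike.congr_fun h a

variable [IsLieAbelian L]

open WithConv in
-- For $x\in L$ the derivation $f\mapsto f(x\,\cdot)$ kills $f^p$ in characteristic $p$, so $f^p$
-- vanishes on all products $x a$. Since $L$ generates $u(L)$, $f^p$ is $f^p(1)=f(1)^p=0$ times the
-- counit.
theorem convPow_eq_zero (f : WithConv (RestrictedEnveloping p k L →ₗ[k] k)) (hf : f.ofConv 1 = 0) :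
    f ^ p = 0 := by
  have hp : p.Prime := Fact.out
  have h1 : ∀ (x : L) (a : RestrictedEnveloping p k L), (f ^ p).ofConv (ι p k L x * a) = 0 :=
    fun x a => by
      rw [← Cobar.mulDerivation_apply (comul_ι x), Derivation.leibniz_pow,
        ← Nat.cast_smul_eq_nsmul k, CharP.cast_eq_zero, zero_smul]
      rfl
  let S : Subalgebra k (RestrictedEnveloping p k L) :=
    { carrier := {a | ∀ b, (f ^ p).ofConv (a * b) = Coalgebra.counit (R := k) a * (f ^ p).ofConv b}
      mul_mem' := fun {a b} ha hb c => by
        rw [mul_assoc, ha, hb, Bialgebra.counit_mul, mul_assoc]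
      add_mem' := fun {a b} ha hb c => by
        rw [add_mul, map_add, ha, hb, map_add, add_mul]
      algebraMap_mem' := fun r b => by
        rw [← Algebra.smul_def, map_smul, Bialgebra.counit_algebraMap, smul_eq_mul] }
  ext a
  have := mem_of_ι_mem S (fun x b => by rw [h1, counit_ι, zero_mul]) a 1
  rw [mul_one, Cobar.convPow_apply_one, hf, zero_pow hp.ne_zero, mul_zero] at this
  exact this

theorem eq_zero_of_omega_mem_B2 [PerfectRing k p] (hp : 2 < p) (w : L)
    (h : Cobar.omega p k (ι p k L w) ∈ Cobar.B2 k (RestrictedEnveloping p k L)) : w = 0 := by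
  rw [← map_eq_zero_iff _ (ι_injective (p := p) (k := k) hp),
    ← Module.forall_dual_apply_eq_zero_iff k]
  intro f
  -- Subtracting $f(1)\varepsilon$ achieves $f(1)=0$ without changing the value on $L$, where the
  -- counit $\varepsilon$ is zero.
  have hf : (f - f 1 • Coalgebra.counit : RestrictedEnveloping p k L →ₗ[k] k) 1 = 0 := by simp
  have := Cobar.apply_eq_zero_of_omega_mem_B2 p hp (comul_ι w) h
    (WithConv.toConv (f - f 1 • Coalgebra.counit)) hf (convPow_eq_zero _ hf)
  simpa [counit_ι] using this

end RestrictedEnveloping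

/-! ### The exterior square as a quotient of the tensor square, and swap symmetry -/

namespace exteriorPower

variable (k : Type*) {M : Type*} [Field k] [AddCommGroup M] [Module k M]

theorem ιMulti_two_swap (a b : M) : ιMulti k 2 ![b, a] = -ιMulti k 2 ![a, b] := by
  have := (ιMulti k 2).map_swap ![a, b] (i := 0) (j := 1) (by decide)
  rw [← this]
  congr 1
  ext i
  fin_cases i <;> rfl

/-- The projection `M ⊗ M → Λ² M`. -/
def ofTensorSq (k : Type*) (M : Type*) [Field k] [AddCommGroup M] [Module k M] :
    M ⊗[k] M →ₗ[k] ⋀[k]^2 M :=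
  TensorProduct.lift <| LinearMap.mk₂ k (fun a b => ιMulti k 2 ![a, b])
    (fun a a' b => (ιMulti k 2).map_vecCons_add ![b] a a')
    (fun c a b => (ιMulti k 2).map_vecCons_smul ![b] c a)
    (fun a b b' => by
      rw [ιMulti_two_swap, ιMulti_two_swap k b, ιMulti_two_swap k b', ← neg_add, neg_inj]
      exact (ιMulti k 2).map_vecCons_add ![a] b b')
    (fun c a b => by
      rw [ιMulti_two_swap, ιMulti_two_swap k b, smul_neg, neg_inj]
      exact (ιMulti k 2).map_vecCons_smul ![a] c b)

theorem ofTensorSq_tmul (a b : M) : ofTensorSq k M (a ⊗ₜ b) = ιMulti k 2 ![a, b] := rfl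

theorem ofTensorSq_comm (t : M ⊗[k] M) :
    ofTensorSq k M (TensorProduct.comm k M M t) = -ofTensorSq k M t := by
  induction t with
  | zero => simp
  | tmul a b => exact ιMulti_two_swap k a b
  | add x y hx hy => rw [map_add, map_add, hx, hy, map_add, neg_add]

theorem ofTensorSq_surjective : Function.Surjective (ofTensorSq k M) := by
  rw [← LinearMap.range_eq_top, ← top_le_iff, ← ιMulti_span k 2 M, Submodule.span_le]
  rintro _ ⟨v, rfl⟩
  refine ⟨v 0 ⊗ₜ v 1, ?_⟩
  rw [ofTensorSq_tmul]
  congr 1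
  ext i
  fin_cases i <;> rfl

end exteriorPower

namespace Cobar

variable (p : ℕ) (k : Type*) {A : Type*} [Field k] [CommRing A] [Bialgebra k A]

theorem comm_omega (x : A) : TensorProduct.comm k A A (omega p k x) = omega p k x := by
  rw [omega, map_sum]
  refine Finset.sum_nbij' (fun i => p - i) (fun i => p - i) ?_ ?_ ?_ ?_ ?_
  · intro i hi; rw [Finset.mem_Ioo] at hi ⊢; omega
  · intro i hi; rw [Finset.mem_Ioo] at hi ⊢; omega
  · intro i hi; rw [Finset.mem_Ioo] at hi; omega
  · intro i hi; rw [Finset.mem_Ioo] at hi; omega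
  · intro i hi
    rw [Finset.mem_Ioo] at hi
    rw [map_smul, TensorProduct.comm_tmul, Nat.choose_symm hi.2.le, Nat.sub_sub_self hi.2.le]

theorem comm_d1 [Coalgebra.IsCocomm k A] (a : A) :
    TensorProduct.comm k A A (d1 k A a) = d1 k A a := by
  rw [d1_apply, map_sub, map_add, TensorProduct.comm_tmul, TensorProduct.comm_tmul,
    Coalgebra.comm_comul, add_comm]

end Cobar

/-! ### The map $\Lambda^2(\mathfrak h)\times\mathfrak h\to\mathrm H^2(\Omega u(\mathfrak h))$ and
its kernel -/

section Decomposition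

variable (p : ℕ) [Fact p.Prime] (k 𝔥 : Type*) [Field k] [CharP k p] [LieRing 𝔥]
    [LieAlgebra k 𝔥] [RestrictedLieAlgebra p k 𝔥] [IsLieAbelian 𝔥]

open RestrictedEnveloping

/-- The map `𝔥 ⊗ 𝔥 → Z²(Ω u(𝔥))`. -/
def tensorCocycle : 𝔥 ⊗[k] 𝔥 →ₗ[k] Cobar.Z2 k (RestrictedEnveloping p k 𝔥) :=
  (TensorProduct.map (ι p k 𝔥) (ι p k 𝔥)).codRestrict _ fun t => by
    induction t with
    | zero => simp
    | tmul a b => exact ι_tmul_ι_mem_Z2 p k a b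
    | add x y hx hy => rw [map_add]; exact add_mem hx hy

theorem coe_tensorCocycle (t : 𝔥 ⊗[k] 𝔥) :
    (tensorCocycle p k 𝔥 t : RestrictedEnveloping p k 𝔥 ⊗[k] RestrictedEnveloping p k 𝔥) =
      TensorProduct.map (ι p k 𝔥) (ι p k 𝔥) t := rfl

/-- The map `𝔥 ⊗ 𝔥 → H²(Ω u(𝔥))`, `a ⊗ b ↦ a ∧ b`. -/
def tensorClass : 𝔥 ⊗[k] 𝔥 →ₗ[k] Cobar.H2 k (RestrictedEnveloping p k 𝔥) :=
  Submodule.mkQ _ ∘ₗ tensorCocycle p k 𝔥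

theorem tensorClass_tmul (a b : 𝔥) : tensorClass p k 𝔥 (a ⊗ₜ b) = wedgeClass p k a b := rfl

variable {p k 𝔥}

theorem mk_eq_zero_iff_mem_B2 {c : RestrictedEnveloping p k 𝔥 ⊗[k] RestrictedEnveloping p k 𝔥}
    (hc : c ∈ Cobar.Z2 k (RestrictedEnveloping p k 𝔥)) :
    (Submodule.Quotient.mk ⟨c, hc⟩ : Cobar.H2 k (RestrictedEnveloping p k 𝔥)) = 0 ↔
      c ∈ Cobar.B2 k (RestrictedEnveloping p k 𝔥) := by
  rw [Submodule.Quotient.mk_eq_zero]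
  rfl

theorem two_ne_zero_of_char (hp : 2 < p) : (2 : k) ≠ 0 := fun h => by
  have := Nat.le_of_dvd two_pos ((CharP.cast_eq_zero_iff k p 2).mp (by exact_mod_cast h))
  omega

theorem wedgeClass_self (hp : 2 < p) (a : 𝔥) : wedgeClass p k a a = 0 := by
  -- For primitive $a$ one has $d^1(a^2)=-2\,a\otimes a$.
  refine (mk_eq_zero_iff_mem_B2 _).mpr ⟨-(2 : k)⁻¹ • ι p k 𝔥 a ^ 2, ?_, ?_⟩
  · exact Cobar.mem_aug.mpr (by simp [counit_ι])
  · rw [map_smul, Cobar.d1_apply, Bialgebra.comul_pow, comul_ι, add_sq,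
      Algebra.TensorProduct.tmul_pow, Algebra.TensorProduct.tmul_pow, one_pow, mul_assoc,
      Algebra.TensorProduct.tmul_mul_tmul, one_mul, mul_one, neg_smul, ← smul_neg, inv_smul_eq_iff₀
      (two_ne_zero_of_char hp), two_smul]
    ring

/-- The map `Λ²(𝔥) → H²(Ω u(𝔥))`, `a ∧ b ↦ [a ⊗ b]`. -/
def exteriorClass (hp : 2 < p) : ⋀[k]^2 𝔥 →ₗ[k] Cobar.H2 k (RestrictedEnveloping p k 𝔥) :=
  exteriorPower.alternatingMapLinearEquiv
    { toFun := fun v => tensorClass p k 𝔥 (v 0 ⊗ₜ v 1)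
      map_update_add' := fun v i x y => by
        fin_cases i <;> simp [Function.update, TensorProduct.add_tmul, TensorProduct.tmul_add]
      map_update_smul' := fun v i c x => by
        fin_cases i <;> simp [Function.update, ← TensorProduct.smul_tmul']
      map_eq_zero_of_eq' := fun v i j hv hij => by
        have h : v 0 = v 1 := by
          fin_cases i <;> fin_cases j <;> simp_all
        change tensorClass p k 𝔥 (v 0 ⊗ₜ v 1) = 0
        rw [h]
        exact wedgeClass_self hp _ }

theorem exteriorClass_ιMulti (hp : 2 < p) (a b : 𝔥) :
    exteriorClass hp (exteriorPower.ιMulti k 2 ![a, b]) = wedgeClass p k a b :=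
  exteriorPower.alternatingMapLinearEquiv_apply_ιMulti _ _

theorem exteriorClass_ofTensorSq (hp : 2 < p) (t : 𝔥 ⊗[k] 𝔥) :
    exteriorClass hp (exteriorPower.ofTensorSq k 𝔥 t) = tensorClass p k 𝔥 t := by
  induction t with
  | zero => simp
  | tmul a b => exact exteriorClass_ιMulti hp a b
  | add x y hx hy => rw [map_add, map_add, hx, hy, map_add]

theorem omegaClass_zero : omegaClass p k (0 : 𝔥) = 0 := by
  refine (mk_eq_zero_iff_mem_B2 _).mpr ?_
  rw [map_zero, Cobar.omega, Finset.sum_eq_zero]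
  · exact zero_mem _
  · intro i hi
    rw [Finset.mem_Ioo] at hi
    rw [zero_pow hi.1.ne', TensorProduct.zero_tmul, smul_zero]

/-- `Λ²(𝔥) × 𝔥 → H²(Ω u(𝔥))`, `(T, w) ↦ T + ω(w)`, has trivial kernel. -/
theorem exteriorClass_add_omegaClass_eq_zero_iff [PerfectRing k p] (hp : 2 < p) (T : ⋀[k]^2 𝔥)
    (w : 𝔥) : exteriorClass hp T + omegaClass p k w = 0 ↔ w = 0 ∧ T = 0 := by
  refine ⟨fun h => ?_, fun ⟨hw, hT⟩ => by rw [hw, hT, map_zero, omegaClass_zero, add_zero]⟩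
  have hT : T = 0 := by
    obtain ⟨t, rfl⟩ := exteriorPower.ofTensorSq_surjective k T
    rw [exteriorClass_ofTensorSq] at h
    obtain ⟨a, -, ha⟩ := (mk_eq_zero_iff_mem_B2 (add_mem (tensorCocycle p k 𝔥 t).2
      (Cobar.omega_mem_Z2 p k (counit_ι w) (comul_ι w)))).mp h
    -- Here $t+\omega(w)=d^1(a)$. Both $\omega(w)$ and $d^1(a)$ are fixed by the swap, hence so is
    -- $t$, first in $u(\mathfrak h)\otimes u(\mathfrak h)$ and then, by injectivity, in $\mathfrak
    -- h\otimes\mathfrak h$. The swap acts as $-1$ on $\Lambda^2$, so $2T=0$.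
    have hs := Cobar.comm_d1 (k := k) a
    rw [ha, map_add, Cobar.comm_omega, add_left_inj, coe_tensorCocycle,
      ← TensorProduct.map_comm] at hs
    have ht := TensorProduct.map_injective_of_flat_flat _ _ (ι_injective hp) (ι_injective hp) hs
    have h2 := exteriorPower.ofTensorSq_comm k t
    rw [ht, eq_neg_iff_add_eq_zero, ← two_smul k] at h2
    exact (smul_eq_zero.mp h2).resolve_left (two_ne_zero_of_char hp)
  rw [hT, map_zero, zero_add] at h
  exact ⟨eq_zero_of_omega_mem_B2 hp w ((mk_eq_zero_iff_mem_B2 _).mp h), hT⟩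

end Decomposition

/-! ### Integral identities for $((a+b)^p-a^p-b^p)/p$ -/

section PowerDefect

variable (p : ℕ)

/-- The polynomial `((a + b) ^ p - a ^ p - b ^ p) / p`. -/
def powerDefect {R : Type*} [CommRing R] (a b : R) : R :=
  ∑ i ∈ Finset.Ioo 0 p, ((p.choose i / p : ℕ) : R) * (a ^ i * b ^ (p - i))

variable {p}

theorem mul_powerDefect (hp : p.Prime) {R : Type*} [CommRing R] (a b : R) :
    (p : R) * powerDefect p a b = (a + b) ^ p - a ^ p - b ^ p := by
  have h := add_pow_prime_eq' hp a b
  rw [powerDefect, h]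
  simp only [mul_comm (((_ : ℕ) : R)) (a ^ _ * _)]
  ring

/-- After multiplication by $p$ both sides become the same expression in $p$-th powers, symmetric in
$b$ and $c$. Cancelling $p$ is legitimate in $\mathbb Z[X_0,\dots,X_3]$, and the result specializes
to any commutative ring. -/
theorem powerDefect_add_add (hp : p.Prime) {R : Type*} [CommRing R] (a b c d : R) :
    powerDefect p (a + b) (c + d) - powerDefect p a c - powerDefect p b d =
      powerDefect p (a + c) (b + d) - powerDefect p a b - powerDefect p c d := by
  have main : ∀ x y z w : MvPolynomial (Fin 4) ℤ,
      powerDefect p (x + y) (z + w) - powerDefect p x z - powerDefect p y w =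
        powerDefect p (x + z) (y + w) - powerDefect p x y - powerDefect p z w := fun x y z w => by
    have hp0 : (p : MvPolynomial (Fin 4) ℤ) ≠ 0 := Nat.cast_ne_zero.mpr hp.ne_zero
    refine mul_left_cancel₀ hp0 ?_
    simp only [mul_sub, mul_powerDefect hp, add_add_add_comm x y z w]
    ring
  have := congrArg (MvPolynomial.aeval (R := ℤ) ![a, b, c, d])
    (main (MvPolynomial.X 0) (MvPolynomial.X 1) (MvPolynomial.X 2) (MvPolynomial.X 3))
  simpa [powerDefect] using this

theorem derivation_powerDefect {S R : Type*} [CommRing S] [CommRing R] [Algebra S R]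
    (D : Derivation S R R) (a b : R) :
    D (powerDefect p a b) = ∑ i ∈ Finset.Ioo 0 p, ((p.choose i / p : ℕ) : R) *
      ((i : R) * (a ^ (i - 1) * D a) * b ^ (p - i) +
        a ^ i * (((p - i : ℕ) : R) * (b ^ (p - i - 1) * D b))) := by
  rw [powerDefect, map_sum]
  refine Finset.sum_congr rfl fun i _ => ?_
  simp only [Derivation.leibniz, Derivation.leibniz_pow, Derivation.map_natCast, smul_eq_mul,
    nsmul_eq_mul]
  ring

theorem mul_derivation_powerDefect (hp : p.Prime) {S R : Type*} [CommRing S] [CommRing R]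
    [Algebra S R] (D : Derivation S R R) (a b : R) : (p : R) * D (powerDefect p a b) =
      p * ((a + b) ^ (p - 1) * (D a + D b) - a ^ (p - 1) * D a - b ^ (p - 1) * D b) := by
  have h := congrArg D (mul_powerDefect hp a b)
  simp only [Derivation.leibniz, map_sub, map_add, Derivation.leibniz_pow, Derivation.map_natCast,
    smul_eq_mul, nsmul_eq_mul, mul_zero, add_zero] at h
  rw [h]
  ring

/-- The derivative of $(a+b)^p-a^p-b^p$ divided by $p$. The division takes place over $\mathbb Z$,
for the universal derivation with $X_0\mapsto X_2$ and $X_1\mapsto X_3$, so the formula survives in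
characteristic $p$. -/
theorem sum_derivative_powerDefect (hp : p.Prime) {R : Type*} [CommRing R] (a b a' b' : R) :
    ∑ i ∈ Finset.Ioo 0 p, ((p.choose i / p : ℕ) : R) *
      ((i : R) * (a ^ (i - 1) * a') * b ^ (p - i) +
        a ^ i * (((p - i : ℕ) : R) * (b ^ (p - i - 1) * b'))) =
    (a + b) ^ (p - 1) * (a' + b') - a ^ (p - 1) * a' - b ^ (p - 1) * b' := by
  let D : Derivation ℤ (MvPolynomial (Fin 4) ℤ) (MvPolynomial (Fin 4) ℤ) :=
    MvPolynomial.mkDerivation ℤ ![.X 2, .X 3, 0, 0]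
  have h0 : D (.X 0) = .X 2 := MvPolynomial.mkDerivation_X _ _ _
  have h1 : D (.X 1) = .X 3 := MvPolynomial.mkDerivation_X _ _ _
  have hp0 : (p : MvPolynomial (Fin 4) ℤ) ≠ 0 := Nat.cast_ne_zero.mpr hp.ne_zero
  have main := mul_left_cancel₀ hp0 (mul_derivation_powerDefect hp D (.X 0) (.X 1))
  rw [derivation_powerDefect, h0, h1] at main
  have := congrArg (MvPolynomial.aeval (R := ℤ) ![a, b, a', b']) main
  simpa using this

end PowerDefect

/-! ### Behaviour of $\omega$ under sums, scalars, $p$-th powers and derivations -/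

namespace Cobar

variable {p : ℕ} [Fact p.Prime] {k A : Type*} [Field k] [CharP k p] [CommRing A]
  [Bialgebra k A]

theorem omega_eq_powerDefect (x : A) :
    omega p k x = powerDefect p (x ⊗ₜ[k] 1) (1 ⊗ₜ[k] x) := by
  refine Finset.sum_congr rfl fun i _ => ?_
  rw [Algebra.smul_def, map_natCast, Algebra.TensorProduct.tmul_pow,
    Algebra.TensorProduct.tmul_pow, Algebra.TensorProduct.tmul_mul_tmul, one_pow, one_pow,
    one_mul, mul_one]

variable (p) in
theorem map_powerDefect {B C : Type*} [CommRing B] [CommRing C] (f : B →+* C) (a b : B) :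
    f (powerDefect p a b) = powerDefect p (f a) (f b) := by
  simp [powerDefect]

/-- `ω` is additive on primitive elements, up to coboundaries. -/
theorem omega_add_sub_mem_B2 {x y : A} (hx : Coalgebra.counit (R := k) x = 0)
    (hΔx : Coalgebra.comul (R := k) x = x ⊗ₜ[k] 1 + 1 ⊗ₜ[k] x)
    (hΔy : Coalgebra.comul (R := k) y = y ⊗ₜ[k] 1 + 1 ⊗ₜ[k] y) :
    omega p k (x + y) - omega p k x - omega p k y ∈ B2 k A := by
  -- `powerDefect_add_add` at $x\otimes1,\ y\otimes1,\ 1\otimes x,\ 1\otimes y$ turns the difference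
  -- into the defect of $(\Delta x,\Delta y)$ minus those of $(x\otimes1,y\otimes1)$ and $(1\otimes
  -- x,1\otimes y)$.
  refine ⟨-powerDefect p x y, ?_, ?_⟩
  · refine neg_mem (mem_aug.mpr ?_)
    change Bialgebra.counitAlgHom k A _ = 0
    rw [powerDefect, map_sum]
    refine Finset.sum_eq_zero fun i hi => ?_
    rw [Finset.mem_Ioo] at hi
    simp [hx, hi.1.ne']
  · have h1 : powerDefect p x y ⊗ₜ[k] (1 : A) = powerDefect p (x ⊗ₜ[k] 1) (y ⊗ₜ[k] 1) :=
      map_powerDefect p (Algebra.TensorProduct.includeLeft : A →ₐ[k] A ⊗[k] A).toRingHom x y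
    have h2 : (1 : A) ⊗ₜ[k] powerDefect p x y = powerDefect p (1 ⊗ₜ[k] x) (1 ⊗ₜ[k] y) :=
      map_powerDefect p (Algebra.TensorProduct.includeRight : A →ₐ[k] A ⊗[k] A).toRingHom x y
    have h3 : Coalgebra.comul (R := k) (powerDefect p x y) = powerDefect p
        (Coalgebra.comul (R := k) x) (Coalgebra.comul (R := k) y) :=
      map_powerDefect p (Bialgebra.comulAlgHom k A).toRingHom x y
    rw [map_neg, d1_apply, h1, h2, h3, hΔx, hΔy, omega_eq_powerDefect, omega_eq_powerDefect,
      omega_eq_powerDefect, TensorProduct.add_tmul, TensorProduct.tmul_add,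
      powerDefect_add_add Fact.out]
    ring

/-- Frobenius is additive on $A\otimes A$ and fixes the coefficients $\frac1p\binom pi$, which lie
in the prime field. -/
theorem omega_pow (x : A) : omega p k x ^ p = omega p k (x ^ p) := by
  let F : A ⊗[k] A →+ A ⊗[k] A :=
    { toFun := fun t => t ^ p
      map_zero' := zero_pow (Fact.out : p.Prime).ne_zero
      map_add' := add_pow_char' p k }
  change F (omega p k x) = _
  rw [omega, map_sum]
  refine Finset.sum_congr rfl fun i _ => ?_
  change (((p.choose i / p : ℕ) : k) • ((x ^ i) ⊗ₜ[k] (x ^ (p - i)))) ^ p = _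
  rw [smul_pow, Algebra.TensorProduct.tmul_pow, ← pow_mul, ← pow_mul, ← pow_mul, ← pow_mul,
    mul_comm i, mul_comm (p - i), ← frobenius_def, map_natCast]

theorem omega_smul (r : k) (x : A) : omega p k (r • x) = r ^ p • omega p k x := by
  rw [omega, omega, Finset.smul_sum]
  refine Finset.sum_congr rfl fun i hi => ?_
  rw [Finset.mem_Ioo] at hi
  rw [smul_pow, smul_pow, TensorProduct.smul_tmul_smul, ← pow_add, Nat.add_sub_cancel' hi.2.le,
    smul_comm]

variable {δ : Derivation k A A}

theorem tensorDer_tmul (a b : A) :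
    tensorDer (δ : A →ₗ[k] A) (a ⊗ₜ b) = δ a ⊗ₜ b + a ⊗ₜ δ b := rfl

theorem tensorDer_mem_B2 (hδ : IsCoder δ) {c : A ⊗[k] A} (hc : c ∈ B2 k A) :
    tensorDer (δ : A →ₗ[k] A) c ∈ B2 k A := by
  obtain ⟨a, -, rfl⟩ := hc
  rw [d1_tensorDer hδ]
  exact ⟨δ a, mem_aug.mpr (hδ.counit a), rfl⟩

/-- `δ(ω(x)) = -d¹(x ^ (p - 1) δ(x))` for primitive `x`. -/
theorem tensorDer_omega_mem_B2 (hδ : IsCoder δ) {x : A}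
    (hx : Coalgebra.comul (R := k) x = x ⊗ₜ[k] 1 + 1 ⊗ₜ[k] x) :
    tensorDer (δ : A →ₗ[k] A) (omega p k x) ∈ B2 k A := by
  have hδx : Coalgebra.comul (R := k) (δ x) = δ x ⊗ₜ[k] 1 + 1 ⊗ₜ[k] δ x := by
    rw [hδ.comul, hx, map_add, tensorDer_tmul, tensorDer_tmul]
    simp
  refine ⟨-(x ^ (p - 1) * δ x), neg_mem (mem_aug.mpr ?_), ?_⟩
  · rw [Bialgebra.counit_mul, hδ.counit, mul_zero]
  · have h := sum_derivative_powerDefect (Fact.out : p.Prime) (x ⊗ₜ[k] (1 : A)) ((1 : A) ⊗ₜ[k] x)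
      (δ x ⊗ₜ[k] (1 : A)) ((1 : A) ⊗ₜ[k] δ x)
    rw [map_neg, d1_apply, Bialgebra.comul_mul, Bialgebra.comul_pow, hx, hδx, neg_sub, omega,
      map_sum, ← sub_sub]
    simp only [Algebra.TensorProduct.tmul_pow, Algebra.TensorProduct.tmul_mul_tmul, one_pow,
      one_mul] at h
    rw [← h]
    refine Finset.sum_congr rfl fun i _ => ?_
    rw [map_smul, tensorDer_tmul, Derivation.leibniz_pow, Derivation.leibniz_pow, Algebra.smul_def,
      map_natCast, ← Nat.cast_smul_eq_nsmul k, ← Nat.cast_smul_eq_nsmul k,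
      ← TensorProduct.smul_tmul', TensorProduct.tmul_smul, Algebra.smul_def (i : k),
      Algebra.smul_def ((p - i : ℕ) : k), map_natCast, map_natCast, mul_assoc (i : A ⊗[k] A),
      mul_left_comm _ ((p - i : ℕ) : A ⊗[k] A)]
    simp only [Algebra.TensorProduct.tmul_mul_tmul, one_mul, mul_one, smul_eq_mul]

theorem tensorDer_pow_omega_mem_B2 (hδ : IsCoder δ) {x : A}
    (hx : Coalgebra.comul (R := k) x = x ⊗ₜ[k] 1 + 1 ⊗ₜ[k] x) (n : ℕ) :
    (tensorDer (δ : A →ₗ[k] A) ^ (n + 1)) (omega p k x) ∈ B2 k A := by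
  induction n with
  | zero => simpa using tensorDer_omega_mem_B2 hδ hx
  | succ n ih =>
    rw [pow_succ', Module.End.mul_apply]
    exact tensorDer_mem_B2 hδ ih

theorem tensorDer_pow_tmul (n : ℕ) (a b : A) :
    (tensorDer (δ : A →ₗ[k] A) ^ n) (a ⊗ₜ b) = ∑ q ∈ Finset.HasAntidiagonal.antidiagonal n,
      (n.choose q.1 : k) • (((δ : A →ₗ[k] A) ^ q.1) a ⊗ₜ[k] ((δ : A →ₗ[k] A) ^ q.2) b) := by
  have hc : Commute ((δ : A →ₗ[k] A).rTensor A) ((δ : A →ₗ[k] A).lTensor A) := by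
    change _ ∘ₗ _ = _ ∘ₗ _
    rw [LinearMap.rTensor_comp_lTensor, LinearMap.lTensor_comp_rTensor]
  rw [tensorDer, hc.add_pow', LinearMap.sum_apply]
  refine Finset.sum_congr rfl fun q _ => ?_
  rw [LinearMap.smul_apply, Module.End.mul_apply, LinearMap.rTensor_pow, LinearMap.lTensor_pow,
    LinearMap.lTensor_tmul, LinearMap.rTensor_tmul, Nat.cast_smul_eq_nsmul]

end Cobar

/-! ### The operator $\Phi_z$ on wedge classes and on $\omega$ -/

namespace AlgebraicRepresentation

open RestrictedEnveloping RestrictedLieAlgebra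

variable {p : ℕ} [Fact p.Prime] {k 𝔤 𝔥 : Type*} [Field k] [CharP k p] [LieRing 𝔤] [LieAlgebra k 𝔤]
    [RestrictedLieAlgebra p k 𝔤] [LieRing 𝔥] [LieAlgebra k 𝔥] [RestrictedLieAlgebra p k 𝔥]
    [IsLieAbelian 𝔥]

theorem act_pow_ι (ρ : AlgebraicRepresentation p k 𝔤 𝔥) (z : 𝔤) (n : ℕ) (x : 𝔥) :
    (((ρ.act z : Derivation k _ _) : RestrictedEnveloping p k 𝔥 →ₗ[k] _) ^ n) (ι p k 𝔥 x) =
      ι p k 𝔥 ((ρ.toLin z ^ n) x) := by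
  induction n with
  | zero => rfl
  | succ n ih =>
    rw [pow_succ', Module.End.mul_apply, ih, pow_succ', Module.End.mul_apply]
    exact ρ.act_ι z _

theorem zOperator_wedgeClass (ρ : AlgebraicRepresentation p k 𝔤 𝔥) (z : 𝔤) (c : k) (a b : 𝔥) :
    ρ.zOperator z c (wedgeClass p k a b) = wedgeClass p k (pMap p k a) (pMap p k b) +
      c • wedgeClass p k a b + ∑ q ∈ Finset.HasAntidiagonal.antidiagonal (p - 1),
        ((p - 1).choose q.1 : k) • wedgeClass p k ((ρ.toLin z ^ q.1) a) ((ρ.toLin z ^ q.2) b) := by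
  simp only [← tensorClass_tmul, ← map_smul, ← map_sum, ← map_add]
  refine congrArg (Submodule.mkQ _) (Subtype.ext ?_)
  change Cobar.phi p _ c (ι p k 𝔥 a ⊗ₜ[k] ι p k 𝔥 b) = _
  rw [coe_tensorCocycle]
  simp only [map_add, map_sum, map_smul, TensorProduct.map_tmul]
  rw [Cobar.phi, Cobar.tensorDer_pow_tmul, Algebra.TensorProduct.tmul_pow, ι_pMap, ι_pMap]
  simp only [act_pow_ι]

theorem zOperator_exteriorClass (hp : 2 < p) (ρ : AlgebraicRepresentation p k 𝔤 𝔥) (z : 𝔤)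
    (c μ : k) (a b : 𝔥) :
    ρ.zOperator z c (μ • wedgeClass p k a b) = exteriorClass hp
      (μ ^ p • exteriorPower.ιMulti k 2 ![pMap p k a, pMap p k b] +
        (c * μ) • exteriorPower.ιMulti k 2 ![a, b] +
        ∑ q ∈ Finset.HasAntidiagonal.antidiagonal (p - 1), (((p - 1).choose q.1 : k) * μ) •
          exteriorPower.ιMulti k 2 ![(ρ.toLin z ^ q.1) a, (ρ.toLin z ^ q.2) b]) := by
  have hw : ∀ (r : k) (a b : 𝔥), wedgeClass p k (r • a) b = r • wedgeClass p k a b :=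
    fun r a b => by
      rw [← tensorClass_tmul, ← TensorProduct.smul_tmul', map_smul, tensorClass_tmul]
  -- The scalar is absorbed into the first factor, since $\Phi_z$ is not $k$-linear; it reappears as
  -- $\mu^p$ through the $p$-map.
  rw [← hw, zOperator_wedgeClass, pMap_smul]
  simp only [map_add, map_sum, map_smul, exteriorClass_ιMulti, hw, smul_smul]

/-- The $p$-th power contributes $\omega(y^p)$, and $c\,\omega(y)=\omega(ry)$ because $\omega$
scales by $p$-th powers. The term with $\rho_z^{p-1}$ is a coboundary, as $p-1\geq1$. Additivity of
$\omega$ modulo coboundaries joins the two remaining terms. -/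
theorem zOperator_omegaClass (hp : 2 < p) (ρ : AlgebraicRepresentation p k 𝔤 𝔥) (z : 𝔤) {c r : k}
    (hr : r ^ p = c) (y : 𝔥) :
    ρ.zOperator z c (omegaClass p k y) = omegaClass p k (pMap p k y + r • y) := by
  refine (Submodule.Quotient.eq _).mpr ?_
  change Cobar.phi p _ c (Cobar.omega p k (ι p k 𝔥 y)) - Cobar.omega p k (ι p k 𝔥 _) ∈ Cobar.B2 k _
  have h1 := Cobar.omega_add_sub_mem_B2 (p := p) (k := k) (x := ι p k 𝔥 (pMap p k y))
    (y := ι p k 𝔥 (r • y)) (counit_ι (pMap p k y))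
    (comul_ι (pMap p k y)) (comul_ι (r • y))
  have h2 := Cobar.tensorDer_pow_omega_mem_B2 (p := p) (ρ.isCoder_act z) (comul_ι y) (p - 2)
  rw [show p - 2 + 1 = p - 1 by omega] at h2
  rw [Cobar.phi, Cobar.omega_pow, ← ι_pMap, ← hr, ← Cobar.omega_smul, ← map_smul, map_add]
  convert sub_mem h2 h1 using 1
  abel

end AlgebraicRepresentation

/-! ### The criterion for $z$-characteristic classes -/

theorem proposition5p7 (p : ℕ) [Fact p.Prime] (hp : 2 < p)
    {k : Type*} [Field k] [CharP k p] [PerfectField k]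
    {𝔤 : Type*} [LieRing 𝔤] [LieAlgebra k 𝔤] [RestrictedLieAlgebra p k 𝔤]
    {𝔥 : Type*} [LieRing 𝔥] [LieAlgebra k 𝔥] [RestrictedLieAlgebra p k 𝔥] [IsLieAbelian 𝔥]
    (ρ : AlgebraicRepresentation p k 𝔤 𝔥)
    (h𝔤 : Module.finrank k 𝔤 = 1) (z : 𝔤) (hz : z ≠ 0)
    (lam : k) (hlam : RestrictedLieAlgebra.pMap p k z + lam • z = 0)
    {d : ℕ} (x : Module.Basis (Fin d) k 𝔥)
    (μ : Fin d → Fin d → k) (ν : Fin d → k) (y : 𝔥) (hy : y = ∑ i, ν i • x i)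
    (ξ : Cobar.H2 k (RestrictedEnveloping p k 𝔥))
    (hξ : ξ = (∑ i, ∑ j ∈ Finset.Ioi i, μ i j • wedgeClass p k (x i) (x j)) + omegaClass p k y) :
    ρ.IsZCharacteristic z lam ξ ↔
      RestrictedLieAlgebra.pMap p k y + (frobeniusEquiv k p).symm lam • y = 0 ∧
      (∑ i, ∑ j ∈ Finset.Ioi i,
          μ i j ^ p • exteriorPower.ιMulti k 2
            ![RestrictedLieAlgebra.pMap p k (x i), RestrictedLieAlgebra.pMap p k (x j)]) +
        (∑ i, ∑ j ∈ Finset.Ioi i, (lam * μ i j) • exteriorPower.ιMulti k 2 ![x i, x j]) +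
        (∑ q ∈ Finset.HasAntidiagonal.antidiagonal (p - 1), ∑ i, ∑ j ∈ Finset.Ioi i,
          (((p - 1).choose q.1 : k) * μ i j) •
            exteriorPower.ιMulti k 2 ![(ρ.toLin z ^ q.1) (x i), (ρ.toLin z ^ q.2) (x j)]) =
        (0 : ⋀[k]^2 𝔥) := by
  have hl : (frobeniusEquiv k p).symm lam ^ p = lam := frobeniusEquiv_symm_pow_p k p lam
  rw [AlgebraicRepresentation.IsZCharacteristic, hξ, map_add, ρ.zOperator_omegaClass hp z hl]
  simp only [map_sum, ρ.zOperator_exteriorClass hp]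
  simp only [← map_sum]
  rw [exteriorClass_add_omegaClass_eq_zero_iff hp]
  simp only [Finset.sum_add_distrib]
  simp only [Finset.sum_comm (s := Finset.HasAntidiagonal.antidiagonal (p - 1))]

end
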